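/- **Proposition (existence of a discrete solution for $k=1$, Cauchy problem).** Let $d\in\{2,3\}$ and let $\Omega\subset\mathbb{R}^d$ be a (nonempty, connected) polygonal/polyhedral domain with $\operatorname{int}\overline\Omega=\Omega$, and let $\mathcal{T}_h$ be a conforming triangulation of $\overline\Omega$ into finitely many nondegenerate closed $d$-simplices $K$, with $h=\max_K \operatorname{diam}K$. Let $\mathcal F_{int}$ be the set of interior $(d-1)$-faces and $h_F=\operatorname{diam}F$. Let $\Gamma_V,\Gamma_W\subset\partial\Omega$ be disjoint connected measurable sets, both of positive surface measure, with $\partial\Omega=\overline{\Gamma}_V\cup\overline{\Gamma}_W$. Let $\kappa\in\mathbb{R}$, let $\gamma_{1,F},\gamma_{2,F}>0$ for $F\in\mathcal F_{int}$, and let $n$ be the outward unit normal on $\partial\Omega$. For $k\ge 0$ let $$X_h^k=\{v\in C^0(\Omega): v|_{K\cap\Omega}\text{ is a polynomial of degree at most }k\text{ for all }K\in\mathcal T_h\}$$ be the space of continuous piecewise polynomials, and define $$a_h(u,v)=\int_\Omega\nabla u\cdot\nabla v\,dx+\kappa\int_\Omega uv\,dx-\int_{\Gamma_V}(\nabla v\cdot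 n)\,u\,ds-\int_{\Gamma_W}(\nabla u\cdot n)\,v\,ds,$$ $$s_{cip}(u,v)=\sum_{F\in\mathcal F_{int}}\int_F\Big(h_F\gamma_{1,F}[\nabla u]\cdot[\nabla v]+h_F^3\gamma_{2,F}[\Delta u][\Delta v]\Big)ds,$$ where $[\cdot]$ is the jump across $F$ and boundary values and derivatives on faces are traces from inside the elements, and $$s_p(u,v)=s_{cip}(u,v)+\int_{\Gamma_V}\big(h^{-1}uv+h(\nabla u\cdot n)(\nabla v\cdot n)\big)ds,\qquad s_a(u,v)=s_{cip}(u,v)+\int_{\Gamma_W}\big(h^{-1}uv+h(\nabla u\cdot n)(\nabla v\cdot n)\big)ds.$$ Let $V_h=X_h^1$. Then for every $f\in L^2(\Omega)$ and every function $u$ on $\Omega$ that is sufficiently regular for $s_p(u,\cdot)$ to be well defined on $V_h$ (all integrals occurring in it converge absolutely), for instance a sufficiently regular solution of $-\Delta u+\kappa u=f$ in $\Omega$, $u=\nabla u\cdot n=0$ on $\Gamma_V$, there is exactly one pair $(u_h,z_h)\in V_h\times V_h$ such that $$a_h(u_h,w_h)+s_a(z_h,w_h)=(f,w_h)_{L^2(\Omega)}\quad\text{for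 all }w_h\in V_h,$$ $$a_h(v_h,z_h)-s_p(u_h,v_h)=-s_p(u,v_h)\quad\text{for all }v_h\in V_h.$$ -/

import Mathlib

open MeasureTheory Set Filter Topology

namespace CauchyFEM

noncomputable section

/-- Euclidean space of dimension `d`. -/
abbrev Pt (d : ℕ) : Type := EuclideanSpace ℝ (Fin d)

/-- A conforming triangulation of the closure of `Ω`: a finite simplicial complex, each of whose
simplices is a face of a `d`-dimensional one, with underlying space `closure Ω`. A simplex is
represented by the finite set of its vertices; the simplex itself is the convex hull. -/
structure Triangulation {d : ℕ} (Ω : Set (Pt d)) extends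
    Geometry.SimplicialComplex ℝ (Pt d) where
  finite_faces : faces.Finite
  pure : ∀ s ∈ faces, ∃ t ∈ faces, s ⊆ t ∧ t.card = d + 1
  space_eq : toSimplicialComplex.space = closure Ω

/-- The closed simplex with the given vertices. -/
def hull {d : ℕ} (T : Finset (Pt d)) : Set (Pt d) := convexHull ℝ (T : Set (Pt d))

/-- The trace from inside the simplex `T`, at the point `x` of `T`, of a function `g` defined
almost everywhere on `T`: the limit of the averages of `g` over `B(x, r) ∩ T` as `r → 0+`.
It is the one-sided limit if `g` has a continuous extension to `T`, and it is the Sobolev trace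
(almost everywhere on the boundary of `T`) if `g` is a Sobolev function on `T`. -/
def cellTrace {d : ℕ} {G : Type} [NormedAddCommGroup G] [NormedSpace ℝ G]
    (T : Finset (Pt d)) (g : Pt d → G) (x : Pt d) : G :=
  limUnder (𝓝[>] (0 : ℝ)) fun r : ℝ => ⨍ y in Metric.ball x r ∩ interior (hull T), g y

/-- The unit normal at a point `x` of the face `T.erase a` of the simplex `T`, pointing out of `T`:
the normalised component of `x - a` orthogonal to that face, where `a` is the opposite vertex. -/
def outerNormal {d : ℕ} (T : Finset (Pt d)) (a x : Pt d) : Pt d :=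
  let w : Pt d := ((vectorSpan ℝ ((T : Set (Pt d)) \ {a}))ᗮ).starProjection (x - a)
  ‖w‖⁻¹ • w

/-- The outward normal derivative `∇v · n` of `v` on the face of `T` opposite to `a`, with the
gradient taken from inside `T`. -/
def normalDeriv {d : ℕ} (T : Finset (Pt d)) (a : Pt d) (v : Pt d → ℝ) (x : Pt d) : ℝ :=
  inner ℝ (cellTrace T (gradient v) x) (outerNormal T a x)

namespace Triangulation

variable {d : ℕ} {Ω : Set (Pt d)} (𝓣 : Triangulation Ω)

/-- The elements `K` of the triangulation: its `d`-dimensional simplices. -/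
def cells : Finset (Finset (Pt d)) :=
  𝓣.finite_faces.toFinset.filter fun T => T.card = d + 1

open Classical in
/-- The elements having `F` as a face. -/
def cellsOn (F : Finset (Pt d)) : Finset (Finset (Pt d)) :=
  𝓣.cells.filter fun T => F ⊆ T

/-- The interior faces: the `(d-1)`-dimensional simplices shared by two elements. -/
def interiorFaces : Finset (Finset (Pt d)) :=
  𝓣.finite_faces.toFinset.filter fun F => F.card = d ∧ (𝓣.cellsOn F).card = 2

/-- The boundary faces: the `(d-1)`-dimensional simplices lying on one element only. -/
def boundaryFaces : Finset (Finset (Pt d)) :=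
  𝓣.finite_faces.toFinset.filter fun F => F.card = d ∧ (𝓣.cellsOn F).card = 1

open Classical in
/-- The vertices `a` of `T` for which the face of `T` opposite to `a` is a boundary face. -/
def boundaryVertices (T : Finset (Pt d)) : Finset (Pt d) :=
  T.filter fun a => T.erase a ∈ 𝓣.boundaryFaces

/-- The mesh parameter `h = max_K diam K`. -/
def meshSize : ℝ := sSup ((fun T => Metric.diam (hull T)) '' (𝓣.cells : Set (Finset (Pt d))))

/-- The finite element space of continuous functions on `Ω` whose restriction to every element is
a polynomial of degree at most `k`. As a normalisation, the functions are
extended by zero outside `Ω`, so that equality of functions means equality on `Ω`. -/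
def feSpace (k : ℕ) : Submodule ℝ (Pt d → ℝ) where
  carrier := {v | (∀ x ∉ Ω, v x = 0) ∧ ContinuousOn v Ω ∧
    ∀ T ∈ 𝓣.cells, ∃ p : MvPolynomial (Fin d) ℝ, p.totalDegree ≤ k ∧
      ∀ x ∈ hull T ∩ Ω, v x = MvPolynomial.eval (fun i => x i) p}
  zero_mem' := ⟨fun _ _ => rfl, continuousOn_const, fun _ _ => ⟨0, by simp, by simp⟩⟩
  add_mem' := by
    rintro v w ⟨hv0, hvc, hvp⟩ ⟨hw0, hwc, hwp⟩
    refine ⟨fun x hx => by simp [hv0 x hx, hw0 x hx], hvc.add hwc, fun T hT => ?_⟩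
    obtain ⟨p, hp, hpv⟩ := hvp T hT
    obtain ⟨q, hq, hqw⟩ := hwp T hT
    exact ⟨p + q, (MvPolynomial.totalDegree_add p q).trans (max_le hp hq),
      fun x hx => by simp [hpv x hx, hqw x hx]⟩
  smul_mem' := by
    rintro c v ⟨hv0, hvc, hvp⟩
    refine ⟨fun x hx => by simp [hv0 x hx], hvc.const_smul c, fun T hT => ?_⟩
    obtain ⟨p, hp, hpv⟩ := hvp T hT
    exact ⟨c • p, (MvPolynomial.totalDegree_smul_le c p).trans hp,
      fun x hx => by simp [hpv x hx]⟩

/-- The product `[∇u] · [∇v]` of gradient jumps on an interior face `F`. For the two elements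
`T₁`, `T₂` sharing `F`, the sum over ordered pairs counts
`(∇u|T₁ - ∇u|T₂) · (∇v|T₁ - ∇v|T₂)` twice. -/
def gradJumpProd (F : Finset (Pt d)) (u v : Pt d → ℝ) (x : Pt d) : ℝ :=
  1 / 2 * ∑ T ∈ 𝓣.cellsOn F, ∑ T' ∈ 𝓣.cellsOn F,
    inner ℝ (cellTrace T (gradient u) x - cellTrace T' (gradient u) x)
      (cellTrace T (gradient v) x - cellTrace T' (gradient v) x)

/-- The product `[Δu] [Δv]` of the jumps of the Laplacians on an interior face `F`. -/
def lapJumpProd (F : Finset (Pt d)) (u v : Pt d → ℝ) (x : Pt d) : ℝ :=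
  1 / 2 * ∑ T ∈ 𝓣.cellsOn F, ∑ T' ∈ 𝓣.cellsOn F,
    (cellTrace T (Laplacian.laplacian u) x - cellTrace T' (Laplacian.laplacian u) x) *
      (cellTrace T (Laplacian.laplacian v) x - cellTrace T' (Laplacian.laplacian v) x)

/-- The integral over the part `Γ` of the boundary, with respect to surface measure, of a function
given facewise: `g T a` is its expression on the boundary face of `T` opposite to `a`. -/
def boundaryIntegral (Γ : Set (Pt d)) (g : Finset (Pt d) → Pt d → Pt d → ℝ) : ℝ :=
  ∑ T ∈ 𝓣.cells, ∑ a ∈ 𝓣.boundaryVertices T,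
    ∫ x in convexHull ℝ ((T : Set (Pt d)) \ {a}) ∩ Γ, g T a x ∂μHE[d - 1]

/-- The discrete bilinear form
`a_h(u,v) = (∇u,∇v) + κ (u,v) - ⟨∇v·n, u⟩_{Γ_V} - ⟨∇u·n, v⟩_{Γ_W}`. -/
def aForm (κ : ℝ) (ΓV ΓW : Set (Pt d)) (u v : Pt d → ℝ) : ℝ :=
  (∫ x in Ω, inner ℝ (gradient u x) (gradient v x)) + κ * (∫ x in Ω, u x * v x)
    - 𝓣.boundaryIntegral ΓV (fun T a x => normalDeriv T a v x * cellTrace T u x)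
    - 𝓣.boundaryIntegral ΓW (fun T a x => normalDeriv T a u x * cellTrace T v x)

/-- The interior penalty form
`s_cip(u,v) = ∑_F ∫_F (h_F γ₁ [∇u]·[∇v] + h_F³ γ₂ [Δu][Δv]) ds` over the interior faces. -/
def sCip (γ₁ γ₂ : Finset (Pt d) → ℝ) (u v : Pt d → ℝ) : ℝ :=
  ∑ F ∈ 𝓣.interiorFaces, ∫ x in hull F,
    (Metric.diam (hull F) * γ₁ F * 𝓣.gradJumpProd F u v x
      + Metric.diam (hull F) ^ 3 * γ₂ F * 𝓣.lapJumpProd F u v x) ∂μHE[d - 1]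

/-- The boundary penalty form `∫_Γ (h⁻¹ u v + h (∇u·n) (∇v·n)) ds`. -/
def sBc (Γ : Set (Pt d)) (u v : Pt d → ℝ) : ℝ :=
  𝓣.boundaryIntegral Γ fun T a x =>
    𝓣.meshSize⁻¹ * (cellTrace T u x * cellTrace T v x)
      + 𝓣.meshSize * (normalDeriv T a u x * normalDeriv T a v x)

/-- The stabilisation `s_cip + s_bc` with boundary penalty on `Γ`; it is `s_p` for `Γ = Γ_V` and
`s_a` for `Γ = Γ_W`. -/
def sForm (γ₁ γ₂ : Finset (Pt d) → ℝ) (Γ : Set (Pt d)) (u v : Pt d → ℝ) : ℝ :=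
  𝓣.sCip γ₁ γ₂ u v + 𝓣.sBc Γ u v

/-- `u` is sufficiently regular for the stabilisation `s(u, ·)` with boundary penalty on `Γ` to be
well defined on the finite element space of order `k`: every integral occurring in `s(u, w)`
converges absolutely. -/
def StabDefined (k : ℕ) (Γ : Set (Pt d)) (u : Pt d → ℝ) : Prop :=
  ∀ w ∈ 𝓣.feSpace k,
    (∀ F ∈ 𝓣.interiorFaces,
      IntegrableOn (𝓣.gradJumpProd F u w) (hull F) μHE[d - 1] ∧
      IntegrableOn (𝓣.lapJumpProd F u w) (hull F) μHE[d - 1]) ∧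
    ∀ T ∈ 𝓣.cells, ∀ a ∈ 𝓣.boundaryVertices T,
      IntegrableOn (fun x => cellTrace T u x * cellTrace T w x)
        (convexHull ℝ ((T : Set (Pt d)) \ {a}) ∩ Γ) μHE[d - 1] ∧
      IntegrableOn (fun x => normalDeriv T a u x * normalDeriv T a w x)
        (convexHull ℝ ((T : Set (Pt d)) \ {a}) ∩ Γ) μHE[d - 1]

/-- `(uh, zh)` solves the discrete system with load `f` and stabilisation data `s_p(u, ·)`. -/
def IsFEMSolution (k : ℕ) (κ : ℝ) (γ₁ γ₂ : Finset (Pt d) → ℝ) (ΓV ΓW : Set (Pt d))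
    (f u uh zh : Pt d → ℝ) : Prop :=
  (∀ w ∈ 𝓣.feSpace k,
    𝓣.aForm κ ΓV ΓW uh w + 𝓣.sForm γ₁ γ₂ ΓW zh w = ∫ x in Ω, f x * w x) ∧
  (∀ v ∈ 𝓣.feSpace k,
    𝓣.aForm κ ΓV ΓW v zh - 𝓣.sForm γ₁ γ₂ ΓV uh v = - 𝓣.sForm γ₁ γ₂ ΓV u v)

end Triangulation

/-- The splitting of the boundary of `Ω` into the part `Γ_V` carrying the Cauchy data of the primal
problem and the part `Γ_W` carrying those of the dual problem. -/
structure IsCauchySplitting {d : ℕ} (Ω ΓV ΓW : Set (Pt d)) : Prop where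
  connected_V : IsConnected ΓV
  connected_W : IsConnected ΓW
  disjoint : ΓV ∩ ΓW = ∅
  cover : frontier Ω = closure ΓV ∪ closure ΓW
  subset_V : ΓV ⊆ frontier Ω
  subset_W : ΓW ⊆ frontier Ω
  measurable_V : MeasurableSet ΓV
  measurable_W : MeasurableSet ΓW
  measure_pos_V : 0 < (μHE[d - 1] : Measure (Pt d)) ΓV
  measure_pos_W : 0 < (μHE[d - 1] : Measure (Pt d)) ΓW

end

end CauchyFEM

/-! The discrete problem is a square linear system on the finite-dimensional space `V_h × V_h`
(`finiteDimensional_feSpace`), so unique solvability for all data reduces to injectivity. For a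
homogeneous solution `(u, z)`, test the first equation with `z` and the second with `u`. Subtracting
cancels `a_h(u, z)` and leaves `s_a(z, z) + s_p(u, u) = 0`. Both terms are nonnegative, hence both
vanish; nothing about `a_h` beyond bilinearity is needed.

It remains to see that each stabilisation is definite on piecewise affine functions
(`eq_zero_of_sForm_self`). Laplacians vanish in the cells, so the interior penalty only measures
gradient jumps. If it vanishes, the constant cell gradients agree across every interior face
(`cellGrad_eq_of_sCip_eq_zero`). The boundary penalty acts on a set of positive surface measure,
which charges some boundary facet. There the affine function and its normal derivative vanish almost
everywhere; the first kills the tangential part of the gradient, the second the normal part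
(`exists_cell_of_sBc_eq_zero`). So all gradients are zero, and connectedness of `Ω` makes the
function zero.

The geometric point is `eq_of_interiorFaces`: agreement across interior faces spreads to all cells.
Faces of codimension at least two are too small to separate a connected open set, and a segment in
general position avoids them. Off these faces, conformity and barycentric coordinates show that a
facet has at most two cells, on opposite sides. -/

namespace CauchyFEM
noncomputable section

/-! ### Barycentric coordinates of a full simplex. -/

variable {d : ℕ}

/-- The finite set `T` is the vertex set of a nondegenerate `d`-simplex in dimension `d`. -/
structure IsFullSimplex (T : Finset (Pt d)) : Prop where
  indep : AffineIndependent ℝ ((↑) : T → Pt d)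
  card_eq : T.card = d + 1

/-- The vertices of a nondegenerate `d`-simplex as an affine basis. -/
def IsFullSimplex.basis {T : Finset (Pt d)} (hT : IsFullSimplex T) :
    AffineBasis T ℝ (Pt d) :=
  ⟨(↑), hT.indep, (hT.indep.affineSpan_eq_top_iff_card_eq_finrank_add_one).2 (by
    simp [hT.card_eq])⟩

open Classical in
/-- The barycentric coordinate of the simplex `T` belonging to the vertex `a`. -/
def bary (T : Finset (Pt d)) (a : Pt d) : Pt d →ᵃ[ℝ] ℝ :=
  if h : IsFullSimplex T ∧ a ∈ T then h.1.basis.coord ⟨a, h.2⟩ else 0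

lemma isClosed_hull (T : Finset (Pt d)) : IsClosed (hull T) :=
  T.finite_toSet.isClosed_convexHull ℝ

lemma isCompact_hull (T : Finset (Pt d)) : IsCompact (hull T) :=
  T.finite_toSet.isCompact_convexHull ℝ

lemma convex_hull (T : Finset (Pt d)) : Convex ℝ (hull T) := convex_convexHull ℝ _

lemma hull_mono {s T : Finset (Pt d)} (h : s ⊆ T) : hull s ⊆ hull T :=
  convexHull_mono (by exact_mod_cast h)

lemma mem_hull_of_mem {T : Finset (Pt d)} {a : Pt d} (h : a ∈ T) : a ∈ hull T :=
  subset_convexHull ℝ _ (by exact_mod_cast h)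

lemma continuous_bary (T : Finset (Pt d)) (a : Pt d) : Continuous (bary T a) :=
  (bary T a).continuous_of_finiteDimensional

namespace IsFullSimplex

variable {T : Finset (Pt d)} (hT : IsFullSimplex T)
include hT

lemma bary_eq {a : Pt d} (ha : a ∈ T) : bary T a = hT.basis.coord ⟨a, ha⟩ := by
  simp [bary, hT, ha]

lemma bary_self {a : Pt d} (ha : a ∈ T) : bary T a a = 1 := by
  rw [hT.bary_eq ha]; exact hT.basis.coord_apply_eq ⟨a, ha⟩

lemma bary_of_ne {a b : Pt d} (ha : a ∈ T) (hb : b ∈ T) (hab : a ≠ b) : bary T a b = 0 := by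
  rw [hT.bary_eq ha]
  exact hT.basis.coord_apply_ne (i := ⟨a, ha⟩) (j := ⟨b, hb⟩) (by simpa using hab)

lemma sum_bary (x : Pt d) : ∑ a ∈ T, bary T a x = 1 := by
  rw [← hT.basis.sum_coord_apply_eq_one x, ← Finset.sum_coe_sort]
  exact Finset.sum_congr rfl fun i _ => by rw [hT.bary_eq i.2]

lemma sum_bary_smul (x : Pt d) : ∑ a ∈ T, bary T a x • a = x := by
  conv_rhs => rw [← hT.basis.linear_combination_coord_eq_self x]
  rw [← Finset.sum_coe_sort]
  exact Finset.sum_congr rfl fun i _ => by rw [hT.bary_eq i.2]; rfl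

lemma range_basis : range hT.basis = (T : Set (Pt d)) := Subtype.range_coe

lemma mem_hull {x : Pt d} : x ∈ hull T ↔ ∀ a ∈ T, 0 ≤ bary T a x := by
  have := hT.basis.convexHull_eq_nonneg_coord
  rw [hT.range_basis] at this
  rw [hull, this]
  simp only [mem_ofPred_eq, Subtype.forall]
  exact forall₂_congr fun a ha => by rw [hT.bary_eq ha]

lemma mem_interior_hull {x : Pt d} : x ∈ interior (hull T) ↔ ∀ a ∈ T, 0 < bary T a x := by
  have := hT.basis.interior_convexHull
  rw [hT.range_basis] at this
  rw [hull, this]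
  simp only [mem_ofPred_eq, Subtype.forall]
  exact forall₂_congr fun a ha => by rw [hT.bary_eq ha]

lemma interior_nonempty : (interior (hull T)).Nonempty :=
  ⟨_, by
    have := hT.basis.centroid_mem_interior_convexHull
    rwa [hT.range_basis] at this⟩

lemma closure_interior : closure (interior (hull T)) = hull T := by
  rw [(convex_hull T).closure_interior_eq_closure_of_nonempty_interior hT.interior_nonempty,
    (isClosed_hull T).closure_eq]

/-- A face is cut out of its simplex by the coordinates of the omitted vertices: if these vanish,
the remaining ones already sum to one and give a convex combination. -/
lemma mem_hull_of_subset {s : Finset (Pt d)} (hs : s ⊆ T) {x : Pt d} :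
    x ∈ hull s ↔ x ∈ hull T ∧ ∀ a ∈ T, a ∉ s → bary T a x = 0 := by
  constructor
  · refine fun hx => ⟨hull_mono hs hx, fun a ha has => ?_⟩
    have hconv : Convex ℝ {y | bary T a y = 0} :=
      (convex_singleton (0 : ℝ)).affine_preimage (bary T a)
    refine convexHull_min (fun b hb => ?_) hconv hx
    have hb : b ∈ s := by exact_mod_cast hb
    exact hT.bary_of_ne ha (hs hb) (by rintro rfl; exact has hb)
  · rintro ⟨hx, h0⟩
    have hsum : ∑ a ∈ s, bary T a x = 1 := by
      rw [← hT.sum_bary x]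
      exact Finset.sum_subset hs h0
    have hx' : ∑ a ∈ s, bary T a x • a = x := by
      conv_rhs => rw [← hT.sum_bary_smul x]
      exact Finset.sum_subset hs fun a ha has => by simp [h0 a ha has]
    rw [← hx']
    exact (convex_hull s).sum_mem (fun a ha => (hT.mem_hull.1 hx) a (hs ha)) hsum
      fun a ha => mem_hull_of_mem ha

/-- Two affine functions agreeing at the vertices of a nondegenerate simplex are equal. -/
lemma affine_eq {f g : Pt d →ᵃ[ℝ] ℝ} (h : ∀ a ∈ T, f a = g a) : f = g := by
  refine AffineMap.ext_on (s := (T : Set (Pt d))) ?_ fun a ha => h a (by exact_mod_cast ha)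
  rw [← hT.range_basis]; exact hT.basis.tot

end IsFullSimplex

end

end CauchyFEM

/-! ### Facets, the codimension-two skeleton and connectivity of the mesh. -/

namespace CauchyFEM
noncomputable section

variable {d : ℕ}

lemma affineSpan_ne_top_of_card_le {s : Finset (Pt d)} (hs : s.card ≤ d) :
    affineSpan ℝ (s : Set (Pt d)) ≠ ⊤ := by
  intro h
  rcases Nat.eq_zero_or_pos s.card with h0 | h0
  · rw [Finset.card_eq_zero.1 h0, Finset.coe_empty, AffineSubspace.span_empty] at h
    exact bot_ne_top h
  · have h1 := finrank_vectorSpan_image_finset_le ℝ (id : Pt d → Pt d) s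
      (n := s.card - 1) (by omega)
    have h2 : vectorSpan ℝ (s : Set (Pt d)) = ⊤ := by
      rw [← direction_affineSpan, h, AffineSubspace.direction_top]
    rw [Finset.coe_image, image_id] at h1
    rw [h2, finrank_top, finrank_euclideanSpace_fin] at h1
    omega

lemma volume_affineSpan_eq_zero {s : Finset (Pt d)} (hs : s.card ≤ d) :
    volume (affineSpan ℝ (s : Set (Pt d)) : Set (Pt d)) = 0 :=
  Measure.addHaar_affineSubspace _ _ (affineSpan_ne_top_of_card_le hs)

lemma hull_subset_affineSpan (s : Finset (Pt d)) :
    hull s ⊆ (affineSpan ℝ (s : Set (Pt d)) : Set (Pt d)) :=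
  convexHull_subset_affineSpan _

namespace Triangulation

variable {Ω : Set (Pt d)} (𝓣 : Triangulation Ω)

lemma mem_cells {T : Finset (Pt d)} : T ∈ 𝓣.cells ↔ T ∈ 𝓣.faces ∧ T.card = d + 1 := by
  simp [cells]

variable {𝓣} in
lemma isFullSimplex {T : Finset (Pt d)} (hT : T ∈ 𝓣.cells) : IsFullSimplex T :=
  ⟨𝓣.indep (𝓣.mem_cells.1 hT).1, (𝓣.mem_cells.1 hT).2⟩

lemma mem_closure_iff {x : Pt d} : x ∈ closure Ω ↔ ∃ T ∈ 𝓣.cells, x ∈ hull T := by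
  rw [← 𝓣.space_eq, Geometry.SimplicialComplex.mem_space_iff]
  constructor
  · rintro ⟨s, hs, hx⟩
    obtain ⟨t, ht, hst, hc⟩ := 𝓣.pure s hs
    exact ⟨t, 𝓣.mem_cells.2 ⟨ht, hc⟩, hull_mono hst hx⟩
  · rintro ⟨T, hT, hx⟩
    exact ⟨T, (𝓣.mem_cells.1 hT).1, hx⟩

variable {𝓣} in
lemma hull_subset_closure {T : Finset (Pt d)} (hT : T ∈ 𝓣.cells) : hull T ⊆ closure Ω :=
  fun _ hx => 𝓣.mem_closure_iff.2 ⟨T, hT, hx⟩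

variable {𝓣} in
lemma interior_hull_subset (hΩ : interior (closure Ω) = Ω) {T : Finset (Pt d)}
    (hT : T ∈ 𝓣.cells) : interior (hull T) ⊆ Ω := by
  rw [← hΩ]; exact interior_mono (hull_subset_closure hT)

include 𝓣 in
lemma isBounded : Bornology.IsBounded Ω := by
  refine Bornology.IsBounded.subset ?_ (subset_closure (s := Ω))
  have : closure Ω ⊆ ⋃ T ∈ 𝓣.cells, hull T := fun x hx => by
    simpa using 𝓣.mem_closure_iff.1 hx
  refine Bornology.IsBounded.subset ?_ this
  exact (Bornology.isBounded_biUnion_finset _).2 fun T _ => (isCompact_hull T).isBounded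

variable {𝓣} in
-- This is how conformity enters: a common point lies in the face spanned by the common vertices, so
-- every other coordinate is zero.
lemma hull_inter_subset {T T' : Finset (Pt d)} (hT : T ∈ 𝓣.cells) (hT' : T' ∈ 𝓣.cells)
    {x : Pt d} (hx : x ∈ hull T) (hx' : x ∈ hull T') {b : Pt d} (hb : b ∈ T) (hb' : b ∉ T') :
    bary T b x = 0 := by
  classical
  have h := 𝓣.inter_subset_convexHull (𝓣.mem_cells.1 hT).1 (𝓣.mem_cells.1 hT').1 ⟨hx, hx'⟩
  have h' : x ∈ hull (T ∩ T') := by simpa [hull] using h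
  exact (((isFullSimplex hT).mem_hull_of_subset Finset.inter_subset_left).1 h').2 b hb
    (by simp [hb'])

variable {𝓣} in
lemma not_mem_of_mem_interior {T T' : Finset (Pt d)} (hT : T ∈ 𝓣.cells) (hT' : T' ∈ 𝓣.cells)
    (hne : T ≠ T') {x : Pt d} (hx : x ∈ interior (hull T)) : x ∉ hull T' := by
  intro hx'
  refine hne (Finset.eq_of_subset_of_card_le (fun b hb => ?_) ?_)
  · by_contra hb'
    exact ((isFullSimplex hT).mem_interior_hull.1 hx b hb).ne'
      (hull_inter_subset hT hT' (interior_subset hx) hx' hb hb')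
  · rw [(isFullSimplex hT).card_eq, (isFullSimplex hT').card_eq]

/-- The union of the faces of codimension at least two. -/
def skeleton : Set (Pt d) :=
  ⋃ T ∈ 𝓣.cells, ⋃ s ∈ T.powerset.filter (fun s => s.card < d), hull s

lemma mem_skeleton {x : Pt d} :
    x ∈ 𝓣.skeleton ↔ ∃ T ∈ 𝓣.cells, ∃ s ⊆ T, s.card < d ∧ x ∈ hull s := by
  simp only [skeleton, Finset.mem_filter, Finset.mem_powerset, mem_iUnion, exists_prop, and_assoc]

variable {𝓣} in
-- Two vanishing coordinates would put the point on a face with `d - 1` vertices, which belongs to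
-- the skeleton.
lemma exists_facet {T : Finset (Pt d)} (hT : T ∈ 𝓣.cells) {x : Pt d} (hx : x ∈ hull T)
    (hxi : x ∉ interior (hull T)) (hxs : x ∉ 𝓣.skeleton) :
    ∃ a ∈ T, bary T a x = 0 ∧ ∀ b ∈ T, b ≠ a → 0 < bary T b x := by
  have hF := isFullSimplex hT
  rw [hF.mem_interior_hull] at hxi
  push Not at hxi
  obtain ⟨a, ha, ha0⟩ := hxi
  have hnn := hF.mem_hull.1 hx
  have ha0 := le_antisymm ha0 (hnn a ha)
  refine ⟨a, ha, ha0, fun b hb hba => (hnn b hb).lt_of_ne' fun hb0 => hxs ?_⟩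
  refine 𝓣.mem_skeleton.2 ⟨T, hT, (T.erase a).erase b,
    (Finset.erase_subset _ _).trans (Finset.erase_subset _ _), ?_, ?_⟩
  · rw [Finset.card_erase_of_mem (by simp [hb, hba]), Finset.card_erase_of_mem ha, hF.card_eq]
    have : 1 < T.card := Finset.one_lt_card.2 ⟨b, hb, a, ha, hba⟩
    rw [hF.card_eq] at this
    omega
  · rw [hF.mem_hull_of_subset ((Finset.erase_subset _ _).trans (Finset.erase_subset _ _))]
    refine ⟨hx, fun c hc hcn => ?_⟩
    by_cases hcb : c = b
    · exact hcb ▸ hb0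
    by_cases hca : c = a
    · exact hca ▸ ha0
    simp [hcb, hca, hc] at hcn

variable {𝓣} in
lemma facet_subset {T T' : Finset (Pt d)} (hT : T ∈ 𝓣.cells) (hT' : T' ∈ 𝓣.cells)
    {a x : Pt d} (hx : x ∈ hull T) (hpos : ∀ b ∈ T, b ≠ a → 0 < bary T b x)
    (hx' : x ∈ hull T') : T.erase a ⊆ T' := by
  intro b hb
  rw [Finset.mem_erase] at hb
  by_contra hb'
  exact (hpos b hb.2 hb.1).ne' (hull_inter_subset hT hT' hx hx' hb.2 hb')

/-- If the cell `T'` contains the facet of `T` opposite to `a`, the barycentric coordinate of `a`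
is a multiple of that of the opposite vertex of `T'`. -/
lemma bary_eq_smul {T T' : Finset (Pt d)} (hT : IsFullSimplex T) (hT' : IsFullSimplex T')
    {a a' : Pt d} (ha : a ∈ T) (ha' : a' ∈ T') (hF : T'.erase a' = T.erase a) (x : Pt d) :
    bary T a x = bary T a a' * bary T' a' x := by
  have : bary T a = bary T a a' • bary T' a' := by
    refine hT'.affine_eq fun b hb => ?_
    by_cases hba : b = a'
    · subst hba; simp [hT'.bary_self ha']
    · have hbF : b ∈ T.erase a := hF ▸ Finset.mem_erase.2 ⟨hba, hb⟩
      rw [Finset.mem_erase] at hbF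
      simp [hT'.bary_of_ne ha' hb (Ne.symm hba), hT.bary_of_ne ha hbF.2 (Ne.symm hbF.1)]
  conv_lhs => rw [this]
  simp

lemma exists_erase_eq {T T' : Finset (Pt d)} (hT : IsFullSimplex T) (hT' : IsFullSimplex T')
    {a : Pt d} (ha : a ∈ T) (hF : T.erase a ⊆ T') : ∃ a' ∈ T', T'.erase a' = T.erase a := by
  have hc : T'.card = (T.erase a).card + 1 := by
    rw [Finset.card_erase_of_mem ha, hT.card_eq, hT'.card_eq]; rfl
  obtain ⟨a', ha', h⟩ := (Finset.covBy_iff_exists_insert.1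
    (Finset.covBy_iff_card_sdiff_eq_one.2 ⟨hF, by
      rw [Finset.card_sdiff_of_subset hF]; omega⟩))
  exact ⟨a', h ▸ Finset.mem_insert_self _ _, by rw [← h, Finset.erase_insert ha']⟩

variable {𝓣} in
/-- Two different cells with a common facet lie on opposite sides of it. -/
lemma bary_neg {T T' : Finset (Pt d)} (hT : T ∈ 𝓣.cells) (hT' : T' ∈ 𝓣.cells) (hne : T ≠ T')
    {a a' : Pt d} (ha : a ∈ T) (ha' : a' ∈ T') (hF : T'.erase a' = T.erase a) (hd : 0 < d) :
    bary T a a' < 0 := by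
  have hT1 := isFullSimplex hT
  have hT2 := isFullSimplex hT'
  by_contra hcon
  push Not at hcon
  rcases hcon.eq_or_lt with h0 | hpos
  · have := bary_eq_smul hT1 hT2 ha ha' hF a
    rw [hT1.bary_self ha, ← h0] at this
    simp at this
  · -- a point of the relative interior of the common facet
    obtain ⟨m, hmF, hmpos⟩ : ∃ m ∈ hull (T.erase a), ∀ b ∈ T, b ≠ a → 0 < bary T b m := by
      have hcard : (T.erase a).card = d := by
        rw [Finset.card_erase_of_mem ha, hT1.card_eq]; rfl
      have hsum : ∑ b ∈ T.erase a, ((d : ℝ)⁻¹) = 1 := by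
        rw [Finset.sum_const, hcard, nsmul_eq_mul]; field_simp
      refine ⟨∑ b ∈ T.erase a, (d : ℝ)⁻¹ • b,
        (convex_hull _).sum_mem (fun _ _ => by positivity) hsum fun b hb => mem_hull_of_mem hb, ?_⟩
      intro b hb hba
      have hcomb := Finset.affineCombination_eq_linear_combination (T.erase a)
        (id : Pt d → Pt d) (fun _ => (d : ℝ)⁻¹) hsum
      simp only [id] at hcomb
      rw [← hcomb, Finset.map_affineCombination _ _ _ hsum,
        Finset.affineCombination_eq_linear_combination _ _ _ hsum]
      refine Finset.sum_pos' (fun c hc => ?_) ⟨b, by simp [hb, hba], ?_⟩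
      · have := hT1.mem_hull.1 (mem_hull_of_mem (Finset.mem_of_mem_erase hc)) b hb
        simp only [Function.comp, id, smul_eq_mul]; positivity
      · simp only [Function.comp, id, smul_eq_mul, hT1.bary_self hb]; positivity
    have hma : bary T a m = 0 :=
      ((hT1.mem_hull_of_subset (Finset.erase_subset _ _)).1 hmF).2 a ha (by simp)
    -- Moving from `m` slightly towards `a'` keeps the coordinates other than that of `a` positive
    -- and makes that of `a` positive. The point enters the interior of `T` while staying in `T'`,
    -- which is impossible for distinct cells.
    have hcont : Continuous fun t : ℝ => AffineMap.lineMap (k := ℝ) m a' t :=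
      AffineMap.lineMap_continuous
    have hev : ∀ᶠ t in 𝓝[>] (0 : ℝ), ∀ b ∈ T, b ≠ a →
        0 < bary T b (AffineMap.lineMap (k := ℝ) m a' t) := by
      refine nhdsWithin_le_nhds ((Finset.eventually_all T).2 fun b hb => ?_)
      by_cases hba : b = a
      · simp [hba]
      · have h0 : 0 < bary T b (AffineMap.lineMap (k := ℝ) m a' (0 : ℝ)) := by
          simpa using hmpos b hb hba
        filter_upwards [((continuous_bary T b).comp hcont).continuousAt.eventually_const_lt h0]
          with t ht _ using ht
    obtain ⟨t, ht, ht01⟩ := (hev.and (Ioo_mem_nhdsGT (zero_lt_one' ℝ))).exists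
    set y := AffineMap.lineMap (k := ℝ) m a' t
    have hya : bary T a y = t * bary T a a' := by
      rw [show bary T a y = AffineMap.lineMap (bary T a m) (bary T a a') t from
        (bary T a).apply_lineMap _ _ _, hma]
      simp [AffineMap.lineMap_apply]
    have hyi : y ∈ interior (hull T) := hT1.mem_interior_hull.2 fun b hb => by
      by_cases hba : b = a
      · rw [hba, hya]; exact mul_pos ht01.1 hpos
      · exact ht b hb hba
    refine not_mem_of_mem_interior hT hT' hne hyi ?_
    exact (convex_hull T').lineMap_mem (hull_mono (hF ▸ Finset.erase_subset _ _) hmF)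
      (mem_hull_of_mem ha') ⟨ht01.1.le, ht01.2.le⟩

variable {𝓣} in
-- Near `x` only the coordinates of the two opposite vertices can change sign. One is a negative
-- multiple of the other, so at every nearby point at least one of them is nonnegative.
lemma hull_union_mem_nhds {T T' : Finset (Pt d)} (hT : T ∈ 𝓣.cells) (hT' : T' ∈ 𝓣.cells)
    (hne : T ≠ T') {a x : Pt d} (ha : a ∈ T) (hx : x ∈ hull T) (hxa : bary T a x = 0)
    (hpos : ∀ b ∈ T, b ≠ a → 0 < bary T b x) (hF : T.erase a ⊆ T') (hxs : x ∉ 𝓣.skeleton)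
    (hd : 0 < d) : hull T ∪ hull T' ∈ 𝓝 x := by
  have hT1 := isFullSimplex hT
  have hT2 := isFullSimplex hT'
  obtain ⟨a', ha', hF'⟩ := exists_erase_eq hT1 hT2 ha hF
  have hneg := bary_neg hT hT' hne ha ha' hF' hd
  have hscal := bary_eq_smul hT1 hT2 ha ha' hF'
  have hxF : x ∈ hull (T.erase a) := by
    refine (hT1.mem_hull_of_subset (Finset.erase_subset _ _)).2 ⟨hx, fun c hc hcn => ?_⟩
    have : c = a := by by_contra h; exact hcn (Finset.mem_erase.2 ⟨h, hc⟩)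
    exact this ▸ hxa
  have hx' : x ∈ hull T' := hull_mono hF hxF
  have hxa' : bary T' a' x = 0 := by
    have := hscal x
    rw [hxa] at this
    exact (mul_eq_zero.1 this.symm).resolve_left hneg.ne
  have hpos' : ∀ b ∈ T', b ≠ a' → 0 < bary T' b x := by
    obtain ⟨c, hc, hc0, hcpos⟩ := exists_facet hT' hx'
      (fun h => ((hT2.mem_interior_hull.1 h) a' ha').ne' hxa') hxs
    have : a' = c := by by_contra h; exact (hcpos a' ha' h).ne' hxa'
    exact this ▸ hcpos
  have hev : ∀ (S : Finset (Pt d)) (c : Pt d), (∀ b ∈ S, b ≠ c → 0 < bary S b x) →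
      ∀ᶠ y in 𝓝 x, ∀ b ∈ S, b ≠ c → 0 < bary S b y := by
    intro S c h
    refine (Finset.eventually_all S).2 fun b hb => ?_
    by_cases hbc : b = c
    · simp [hbc]
    · filter_upwards [(continuous_bary S b).continuousAt.eventually_const_lt (h b hb hbc)]
        with y hy _ using hy
  filter_upwards [hev T a hpos, hev T' a' hpos'] with y hy hy'
  rcases le_total 0 (bary T a y) with h | h
  · refine Or.inl (hT1.mem_hull.2 fun b hb => ?_)
    by_cases hba : b = a
    · exact hba ▸ h
    · exact (hy b hb hba).le
  · refine Or.inr (hT2.mem_hull.2 fun b hb => ?_)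
    by_cases hba : b = a'
    · rw [hba]
      rw [hscal y] at h
      by_contra hcon
      push Not at hcon
      nlinarith [mul_pos_of_neg_of_neg hneg hcon]
    · exact (hy' b hb hba).le

variable {𝓣} in
lemma mem_cellsOn {F T : Finset (Pt d)} : T ∈ 𝓣.cellsOn F ↔ T ∈ 𝓣.cells ∧ F ⊆ T := by
  simp [cellsOn]

variable {𝓣} in
-- Three cells on one facet would lie pairwise on opposite sides of it; the scaling factors
-- multiply, and a product of two negative ones is not negative.
lemma card_cellsOn_le_two {T : Finset (Pt d)} (hT : T ∈ 𝓣.cells) {a : Pt d} (ha : a ∈ T)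
    (hd : 0 < d) : (𝓣.cellsOn (T.erase a)).card ≤ 2 := by
  classical
  by_contra hcon
  push Not at hcon
  have hmem : T ∈ 𝓣.cellsOn (T.erase a) := mem_cellsOn.2 ⟨hT, Finset.erase_subset _ _⟩
  have h1 : 1 < ((𝓣.cellsOn (T.erase a)).erase T).card := by
    rw [Finset.card_erase_of_mem hmem]; omega
  obtain ⟨T₁, h₁, T₂, h₂, hne⟩ := Finset.one_lt_card.1 h1
  rw [Finset.mem_erase, mem_cellsOn] at h₁ h₂
  have hT0 := isFullSimplex hT
  have hF1 := isFullSimplex h₁.2.1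
  have hF2 := isFullSimplex h₂.2.1
  obtain ⟨a₁, ha₁, he₁⟩ := exists_erase_eq hT0 hF1 ha h₁.2.2
  obtain ⟨a₂, ha₂, he₂⟩ := exists_erase_eq hT0 hF2 ha h₂.2.2
  have n1 := bary_neg hT h₁.2.1 h₁.1.symm ha ha₁ he₁ hd
  have n2 := bary_neg hT h₂.2.1 h₂.1.symm ha ha₂ he₂ hd
  have n3 := bary_neg h₁.2.1 h₂.2.1 hne ha₁ ha₂ (he₂.trans he₁.symm) hd
  rw [bary_eq_smul hT0 hF1 ha ha₁ he₁ a₂] at n2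
  nlinarith [mul_pos_of_neg_of_neg n1 n3]

variable {𝓣} in
lemma erase_mem_faces {T : Finset (Pt d)} (hT : T ∈ 𝓣.cells) {a : Pt d} (ha : a ∈ T)
    (hd : 0 < d) : T.erase a ∈ 𝓣.faces ∧ (T.erase a).card = d := by
  have hc : (T.erase a).card = d := by
    rw [Finset.card_erase_of_mem ha, (isFullSimplex hT).card_eq]; rfl
  exact ⟨(𝓣.isRelLowerSet_faces (𝓣.mem_cells.1 hT).1).2 (Finset.erase_subset _ _)
    (Finset.card_pos.1 (by omega)), hc⟩

/-- Off the skeleton, a point common to two cells lies on an interior face shared by them. -/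
lemma exists_interiorFace {x : Pt d} (hxs : x ∉ 𝓣.skeleton) {T T' : Finset (Pt d)}
    (hT : T ∈ 𝓣.cells) (hT' : T' ∈ 𝓣.cells) (hne : T ≠ T') (hx : x ∈ hull T)
    (hx' : x ∈ hull T') (hd : 0 < d) :
    ∃ F ∈ 𝓣.interiorFaces, T ∈ 𝓣.cellsOn F ∧ T' ∈ 𝓣.cellsOn F := by
  obtain ⟨a, ha, -, hpos⟩ := exists_facet hT hx
    (fun h => not_mem_of_mem_interior hT hT' hne h hx') hxs
  have h1 : T ∈ 𝓣.cellsOn (T.erase a) := mem_cellsOn.2 ⟨hT, Finset.erase_subset _ _⟩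
  have h2 : T' ∈ 𝓣.cellsOn (T.erase a) := mem_cellsOn.2 ⟨hT', facet_subset hT hT' hx hpos hx'⟩
  refine ⟨T.erase a, ?_, h1, h2⟩
  obtain ⟨hf, hc⟩ := erase_mem_faces hT ha hd
  have : 1 < (𝓣.cellsOn (T.erase a)).card := Finset.one_lt_card.2 ⟨T, h1, T', h2, hne⟩
  have := card_cellsOn_le_two hT ha hd
  simp only [interiorFaces, Finset.mem_filter, Finite.mem_toFinset]
  exact ⟨hf, hc, by omega⟩

variable {𝓣} in
lemma mem_boundaryVertices {T : Finset (Pt d)} {a : Pt d} :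
    a ∈ 𝓣.boundaryVertices T ↔ a ∈ T ∧ T.erase a ∈ 𝓣.faces ∧ (T.erase a).card = d ∧
      (𝓣.cellsOn (T.erase a)).card = 1 := by
  rw [boundaryVertices, Finset.mem_filter, boundaryFaces, Finset.mem_filter, Finite.mem_toFinset]

/-- Off the skeleton, the boundary of `Ω` is covered by the boundary faces. -/
lemma exists_boundaryFace (hΩ : interior (closure Ω) = Ω) {x : Pt d} (hx : x ∈ frontier Ω)
    (hxs : x ∉ 𝓣.skeleton) (hd : 0 < d) :
    ∃ T ∈ 𝓣.cells, ∃ a ∈ 𝓣.boundaryVertices T, x ∈ hull (T.erase a) := by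
  have hΩo : IsOpen Ω := hΩ ▸ isOpen_interior
  rw [frontier, hΩo.interior_eq] at hx
  obtain ⟨T, hT, hxT⟩ := 𝓣.mem_closure_iff.1 hx.1
  have hF := isFullSimplex hT
  obtain ⟨a, ha, ha0, hpos⟩ := exists_facet hT hxT
    (fun h => hx.2 (interior_hull_subset hΩ hT h)) hxs
  obtain ⟨hf, hc⟩ := erase_mem_faces hT ha hd
  refine ⟨T, hT, a, ?_, ?_⟩
  · have h1 : T ∈ 𝓣.cellsOn (T.erase a) := mem_cellsOn.2 ⟨hT, Finset.erase_subset _ _⟩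
    -- A second cell on the facet would give `x` a neighbourhood inside `closure Ω`, so `x` would
    -- lie in `interior (closure Ω) = Ω`.
    have hcard : (𝓣.cellsOn (T.erase a)).card = 1 := by
      refine Finset.card_eq_one.2 ⟨T, Finset.eq_singleton_iff_unique_mem.2 ⟨h1, fun T' hT' => ?_⟩⟩
      by_contra hne
      rw [mem_cellsOn] at hT'
      refine hx.2 ?_
      rw [← hΩ, mem_interior_iff_mem_nhds]
      exact mem_of_superset
        (hull_union_mem_nhds hT hT'.1 (Ne.symm hne) ha hxT ha0 hpos hT'.2 hxs hd)
        (union_subset (hull_subset_closure hT) (hull_subset_closure hT'.1))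
    exact mem_boundaryVertices.2 ⟨ha, hf, hc, hcard⟩
  · refine (hF.mem_hull_of_subset (Finset.erase_subset _ _)).2 ⟨hxT, fun c hc hcn => ?_⟩
    have : c = a := by by_contra h; exact hcn (Finset.mem_erase.2 ⟨h, hc⟩)
    exact this ▸ ha0

variable {𝓣} in
/-- Cellwise data that agree whenever two cells meet in a preconnected set agree for any two cells
that meet this set. -/
lemma eq_of_isPreconnected {α : Type*} {C : Set (Pt d)} (hC : IsPreconnected C)
    (hCΩ : C ⊆ closure Ω) {φ : Finset (Pt d) → α}
    (hφ : ∀ x ∈ C, ∀ T ∈ 𝓣.cells, ∀ T' ∈ 𝓣.cells, x ∈ hull T → x ∈ hull T' → φ T = φ T')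
    {T T' : Finset (Pt d)} (hT : T ∈ 𝓣.cells) (hT' : T' ∈ 𝓣.cells)
    (hCT : (C ∩ hull T).Nonempty) (hCT' : (C ∩ hull T').Nonempty) : φ T = φ T' := by
  classical
  by_contra hne
  have hcl : ∀ p : Finset (Pt d) → Prop, IsClosed (⋃ S ∈ 𝓣.cells.filter p, hull S) :=
    fun p => isClosed_biUnion_finset fun S _ => isClosed_hull S
  -- The cells with value `φ T` and those with another value form two closed sets covering `C`;
  -- preconnectedness yields a common point, where `hφ` is violated.
  obtain ⟨x, hxC, hx1, hx2⟩ := isPreconnected_closed_iff.1 hC _ _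
    (hcl fun S => φ S = φ T) (hcl fun S => φ S ≠ φ T)
    (fun x hx => by
      obtain ⟨S, hS, hxS⟩ := 𝓣.mem_closure_iff.1 (hCΩ hx)
      by_cases h : φ S = φ T
      · exact Or.inl (mem_biUnion (by simpa using ⟨hS, h⟩) hxS)
      · exact Or.inr (mem_biUnion (by simpa using ⟨hS, h⟩) hxS))
    (by
      obtain ⟨x, hx, hxT⟩ := hCT
      exact ⟨x, hx, mem_biUnion (by simpa using hT) hxT⟩)
    (by
      obtain ⟨x, hx, hxT⟩ := hCT'
      exact ⟨x, hx, mem_biUnion (by simpa using ⟨hT', Ne.symm hne⟩) hxT⟩)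
  simp only [Finset.mem_filter, mem_iUnion, exists_prop] at hx1 hx2
  obtain ⟨S, ⟨hS, hS1⟩, hxS⟩ := hx1
  obtain ⟨S', ⟨hS', hS1'⟩, hxS'⟩ := hx2
  exact hS1' (hφ x hxC S hS S' hS' hxS hxS' ▸ hS1)

lemma volume_skeleton : volume 𝓣.skeleton = 0 := by
  refine (measure_biUnion_null_iff 𝓣.cells.countable_toSet).2 fun T _ =>
    (measure_biUnion_null_iff (Finset.countable_toSet _)).2 fun s hs => ?_
  exact measure_mono_null (hull_subset_affineSpan s)
    (volume_affineSpan_eq_zero (by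
      have := (Finset.mem_filter.1 (Finset.mem_coe.1 hs)).2
      exact this.le))

/-- The points that can be joined to `y` by a segment meeting the skeleton form a null set. -/
lemma volume_shadow (y : Pt d) : volume
    (⋃ T ∈ 𝓣.cells, ⋃ s ∈ T.powerset.filter (fun s => s.card < d),
      (affineSpan ℝ (insert y (s : Set (Pt d))) : Set (Pt d))) = 0 := by
  classical
  refine (measure_biUnion_null_iff 𝓣.cells.countable_toSet).2 fun T _ =>
    (measure_biUnion_null_iff (Finset.countable_toSet _)).2 fun s hs => ?_
  have h := (Finset.mem_filter.1 (Finset.mem_coe.1 hs)).2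
  rw [← Finset.coe_insert]
  exact volume_affineSpan_eq_zero ((Finset.card_insert_le _ _).trans h)

lemma exists_mem_notMem_of_null {U N : Set (Pt d)} (hU : IsOpen U) (hne : U.Nonempty)
    (hN : volume N = 0) : ∃ y ∈ U, y ∉ N := by
  by_contra hcon
  push Not at hcon
  exact (hU.measure_pos volume hne).ne' (measure_mono_null hcon hN)

variable {𝓣} in
/-- Cellwise data that agree across the interior faces agree on all cells. -/
lemma eq_of_interiorFaces {α : Type*} (hΩ : interior (closure Ω) = Ω) (hconn : IsConnected Ω)
    (hd : 0 < d) {φ : Finset (Pt d) → α}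
    (hφ : ∀ F ∈ 𝓣.interiorFaces, ∀ T ∈ 𝓣.cellsOn F, ∀ T' ∈ 𝓣.cellsOn F, φ T = φ T')
    {T T' : Finset (Pt d)} (hT : T ∈ 𝓣.cells) (hT' : T' ∈ 𝓣.cells) : φ T = φ T' := by
  have hΩo : IsOpen Ω := hΩ ▸ isOpen_interior
  have hmeet : ∀ S ∈ 𝓣.cells, (Ω ∩ hull S).Nonempty := fun S hS => by
    obtain ⟨y, hy⟩ := (isFullSimplex hS).interior_nonempty
    exact ⟨y, interior_hull_subset hΩ hS hy, interior_subset hy⟩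
  refine eq_of_isPreconnected hconn.isPreconnected subset_closure ?_ hT hT' (hmeet T hT)
    (hmeet T' hT')
  intro x hx S hS S' hS' hxS hxS'
  obtain ⟨r, hr, hball⟩ := Metric.isOpen_iff.1 hΩo x hx
  have hopen : ∀ R : Finset (Pt d), IsOpen (Metric.ball x r ∩ interior (hull R)) :=
    fun R => Metric.isOpen_ball.inter isOpen_interior
  have hne : ∀ R ∈ 𝓣.cells, x ∈ hull R → (Metric.ball x r ∩ interior (hull R)).Nonempty := by
    intro R hR hxR
    rw [← (isFullSimplex hR).closure_interior] at hxR
    exact mem_closure_iff_nhds.1 hxR _ (Metric.ball_mem_nhds x hr)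
  -- General position: `y` avoids the skeleton and `y'` avoids all spans of `y` with a skeleton
  -- face, so the segment between them stays in `Ω` and misses the skeleton.
  obtain ⟨y, ⟨hyb, hyS⟩, hysk⟩ :=
    exists_mem_notMem_of_null (hopen S) (hne S hS hxS) 𝓣.volume_skeleton
  obtain ⟨y', ⟨hyb', hyS'⟩, hysh⟩ :=
    exists_mem_notMem_of_null (hopen S') (hne S' hS' hxS') (𝓣.volume_shadow y)
  have hsegΩ : segment ℝ y y' ⊆ Ω := ((convex_ball x r).segment_subset hyb hyb').trans hball
  have hsegsk : ∀ z ∈ segment ℝ y y', z ∉ 𝓣.skeleton := by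
    intro z hz hzs
    rw [segment_eq_image_lineMap] at hz
    obtain ⟨t, -, rfl⟩ := hz
    obtain ⟨R, hR, s, hs, hsc, hzs'⟩ := 𝓣.mem_skeleton.1 hzs
    have ht0 : t ≠ 0 := by
      rintro rfl
      simp only [AffineMap.lineMap_apply_zero] at hzs
      exact hysk hzs
    refine hysh (mem_biUnion hR (mem_biUnion (by simpa using ⟨hs, hsc⟩) ?_))
    have h1 : y ∈ affineSpan ℝ (insert y (s : Set (Pt d))) :=
      subset_affineSpan ℝ _ (mem_insert _ _)
    have h2 := affineSpan_mono ℝ (subset_insert y (s : Set (Pt d))) (hull_subset_affineSpan s hzs')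
    -- Extrapolating by `t⁻¹` from `y` through the skeleton point recovers `y'`, which would put
    -- `y'` in the excluded span.
    have h3 := AffineMap.lineMap_mem (Q := affineSpan ℝ (insert y (s : Set (Pt d)))) t⁻¹ h1 h2
    convert h3 using 1
    simp [AffineMap.lineMap_apply, smul_smul, ht0]
  refine eq_of_isPreconnected (convex_segment y y').isPreconnected
    (hsegΩ.trans subset_closure) ?_ hS hS'
    ⟨y, left_mem_segment ℝ y y', interior_subset hyS⟩
    ⟨y', right_mem_segment ℝ y y', interior_subset hyS'⟩
  intro z hz R hR R' hR' hzR hzR'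
  by_cases h : R = R'
  · rw [h]
  · obtain ⟨F, hF, h1, h2⟩ := 𝓣.exists_interiorFace (hsegsk z hz) hR hR' h hzR hzR' hd
    exact hφ F hF R h1 R' h2

end Triangulation

end

end CauchyFEM

/-! ### Traces, gradients and Laplacians of piecewise affine functions. -/

namespace CauchyFEM
noncomputable section

variable {d : ℕ}

/-- A polynomial of degree at most one is an affine function. -/
lemma exists_eval_eq_inner (p : MvPolynomial (Fin d) ℝ) (hp : p.totalDegree ≤ 1) :
    ∃ (g : Pt d) (c : ℝ), ∀ x : Pt d, MvPolynomial.eval (fun i => x i) p = inner ℝ g x + c := by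
  have key : ∀ s : Finset (Fin d →₀ ℕ), s ⊆ p.support → ∃ (g : Pt d) (c : ℝ), ∀ x : Pt d,
      ∑ m ∈ s, p.coeff m * ∏ i, x i ^ m i = inner ℝ g x + c := by
    classical
    intro s
    induction s using Finset.induction_on with
    | empty => exact fun _ => ⟨0, 0, by simp⟩
    | insert m s hm ih =>
      intro hs
      obtain ⟨g, c, h⟩ := ih ((Finset.subset_insert _ _).trans hs)
      have hdeg : m.degree ≤ 1 :=
        (MvPolynomial.le_totalDegree (hs (Finset.mem_insert_self _ _))).trans hp
      rcases Nat.le_one_iff_eq_zero_or_eq_one.1 hdeg with h0 | h1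
      · rw [Finsupp.degree_eq_zero_iff] at h0
        subst h0
        refine ⟨g, c + p.coeff 0, fun x => ?_⟩
        rw [Finset.sum_insert hm, h x]
        simp; ring
      · obtain ⟨i, rfl⟩ := (Finsupp.sum_eq_one_iff m).1 h1
        refine ⟨g + p.coeff (Finsupp.single i 1) • EuclideanSpace.single i (1 : ℝ), c,
          fun x => ?_⟩
        rw [Finset.sum_insert hm, h x, inner_add_left, real_inner_smul_left,
          EuclideanSpace.inner_single_left]
        have : ∏ j, x j ^ (Finsupp.single i 1) j = x i := by
          rw [Finset.prod_eq_single i (fun j _ hj => by simp [hj.symm])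
            (by simp)]
          simp
        rw [this]
        simp; ring
  obtain ⟨g, c, h⟩ := key p.support subset_rfl
  exact ⟨g, c, fun x => by rw [MvPolynomial.eval_eq', h x]⟩

lemma measurableSet_interior_hull (T : Finset (Pt d)) : MeasurableSet (interior (hull T)) :=
  isOpen_interior.measurableSet

lemma cellTrace_congr {G : Type} [NormedAddCommGroup G] [NormedSpace ℝ G] {T : Finset (Pt d)}
    {f g : Pt d → G} (h : ∀ y ∈ interior (hull T), f y = g y) (x : Pt d) :
    cellTrace T f x = cellTrace T g x := by
  unfold cellTrace
  congr 1
  ext r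
  exact setAverage_congr_fun (measurableSet_ball.inter (measurableSet_interior_hull T))
    (Eventually.of_forall fun y hy => h y hy.2)

/-- The averages stay in a small closed ball around `g x` by convexity. The averaging sets have
positive measure because a full simplex is the closure of its interior. -/
lemma cellTrace_of_continuous {G : Type} [NormedAddCommGroup G] [NormedSpace ℝ G]
    [CompleteSpace G] {T : Finset (Pt d)} (hT : IsFullSimplex T)
    {g : Pt d → G} (hg : Continuous g) {x : Pt d} (hx : x ∈ hull T) : cellTrace T g x = g x := by
  refine Tendsto.limUnder_eq (Metric.tendsto_nhds.2 fun ε hε => ?_)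
  obtain ⟨δ, hδ, hball⟩ := Metric.continuousAt_iff.1 hg.continuousAt (ε / 2) (half_pos hε)
  filter_upwards [Ioo_mem_nhdsGT hδ] with r hr
  have hmem : ⨍ y in Metric.ball x r ∩ interior (hull T), g y ∈ Metric.closedBall (g x) (ε / 2) := by
    refine (convex_closedBall _ _).set_average_mem Metric.isClosed_closedBall ?_ ?_ ?_ ?_
    · rw [← hT.closure_interior] at hx
      exact ((Metric.isOpen_ball.inter isOpen_interior).measure_pos volume
        (mem_closure_iff_nhds.1 hx _ (Metric.ball_mem_nhds x hr.1))).ne'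
    · exact ((measure_mono inter_subset_left).trans_lt measure_ball_lt_top).ne
    · filter_upwards [ae_restrict_mem (measurableSet_ball.inter (measurableSet_interior_hull T))]
        with y hy
      exact (hball (lt_trans hy.1 hr.2)).le
    · exact (hg.continuousOn.integrableOn_compact (isCompact_closedBall x r)).mono_set
        (inter_subset_left.trans Metric.ball_subset_closedBall)
  exact lt_of_le_of_lt hmem (half_lt_self hε)

open Classical in
/-- A point of the interior of the simplex `T`. -/
def cellPoint (T : Finset (Pt d)) : Pt d :=
  if h : (interior (hull T)).Nonempty then h.some else 0

lemma IsFullSimplex.cellPoint_mem {T : Finset (Pt d)} (hT : IsFullSimplex T) :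
    cellPoint T ∈ interior (hull T) := by
  rw [cellPoint, dif_pos hT.interior_nonempty]
  exact hT.interior_nonempty.some_mem

/-- The gradient of `v` at an interior point of `T`. -/
def cellGrad (T : Finset (Pt d)) (v : Pt d → ℝ) : Pt d := gradient v (cellPoint T)

/-- The first order Taylor polynomial of `v` at an interior point of `T`. -/
def cellAffine (T : Finset (Pt d)) (v : Pt d → ℝ) (x : Pt d) : ℝ :=
  v (cellPoint T) + inner ℝ (cellGrad T v) (x - cellPoint T)

lemma continuous_cellAffine (T : Finset (Pt d)) (v : Pt d → ℝ) :
    Continuous (cellAffine T v) := by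
  unfold cellAffine; fun_prop

lemma cellAffine_add_inner (T : Finset (Pt d)) (v : Pt d → ℝ) (x y : Pt d) :
    cellAffine T v y = cellAffine T v x + inner ℝ (cellGrad T v) (y - x) := by
  simp only [cellAffine, inner_sub_right]; ring

lemma hasGradientAt_inner_add (g : Pt d) (c : ℝ) (x : Pt d) :
    HasGradientAt (fun y => inner ℝ g y + c) g x := by
  rw [hasGradientAt_iff_hasFDerivAt]
  exact (((innerSL ℝ) g).hasFDerivAt (x := x)).add_const c

namespace Triangulation

variable {Ω : Set (Pt d)} {𝓣 : Triangulation Ω}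

section

variable (hΩ : interior (closure Ω) = Ω) {v : Pt d → ℝ} (hv : v ∈ 𝓣.feSpace 1)
  {T : Finset (Pt d)} (hT : T ∈ 𝓣.cells)
include hv hT

lemma exists_affine : ∃ (g : Pt d) (c : ℝ), ∀ x ∈ hull T ∩ Ω, v x = inner ℝ g x + c := by
  obtain ⟨p, hp, hpv⟩ := hv.2.2 T hT
  obtain ⟨g, c, h⟩ := exists_eval_eq_inner p hp
  exact ⟨g, c, fun x hx => (hpv x hx).trans (h x)⟩

include hΩ

lemma exists_affine' : ∃ c : ℝ, (∀ x ∈ hull T ∩ Ω, v x = inner ℝ (cellGrad T v) x + c) ∧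
    ∀ x ∈ interior (hull T), HasGradientAt v (cellGrad T v) x := by
  obtain ⟨g, c, h⟩ := exists_affine hv hT
  have hgrad : ∀ x ∈ interior (hull T), HasGradientAt v g x := fun x hx => by
    refine (hasGradientAt_inner_add g c x).congr_of_eventuallyEq ?_
    filter_upwards [isOpen_interior.mem_nhds hx] with y hy
    exact h y ⟨interior_subset hy, interior_hull_subset hΩ hT hy⟩
  have hg : cellGrad T v = g := (hgrad _ (isFullSimplex hT).cellPoint_mem).gradient
  exact ⟨c, hg ▸ h, hg ▸ hgrad⟩

lemma eq_cellAffine {x : Pt d} (hx : x ∈ hull T) (hxΩ : x ∈ Ω) : v x = cellAffine T v x := by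
  obtain ⟨c, h, -⟩ := exists_affine' hΩ hv hT
  have hp := (isFullSimplex hT).cellPoint_mem
  rw [h x ⟨hx, hxΩ⟩, cellAffine, h _ ⟨interior_subset hp, interior_hull_subset hΩ hT hp⟩,
    inner_sub_right]
  ring

lemma hasGradientAt_cell {x : Pt d} (hx : x ∈ interior (hull T)) :
    HasGradientAt v (cellGrad T v) x := by
  obtain ⟨c, -, h⟩ := exists_affine' hΩ hv hT
  exact h x hx

lemma laplacian_cell {x : Pt d} (hx : x ∈ interior (hull T)) :
    Laplacian.laplacian v x = 0 := by
  obtain ⟨c, h, -⟩ := exists_affine' hΩ hv hT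
  have hev : v =ᶠ[𝓝 x] fun y => inner ℝ (cellGrad T v) y + c := by
    filter_upwards [isOpen_interior.mem_nhds hx] with y hy
    exact h y ⟨interior_subset hy, interior_hull_subset hΩ hT hy⟩
  rw [InnerProductSpace.laplacian_congr_nhds hev |>.eq_of_nhds,
    InnerProductSpace.laplacian_eq_iteratedFDeriv_stdOrthonormalBasis]
  refine Finset.sum_eq_zero fun i _ => ?_
  have hf : fderiv ℝ (fun y : Pt d => inner ℝ (cellGrad T v) y + c)
      = fun _ => (innerSL ℝ) (cellGrad T v) := by
    ext1 y
    exact ((((innerSL ℝ) (cellGrad T v)).hasFDerivAt (x := y)).add_const c).fderiv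
  rw [iteratedFDeriv_two_apply, hf]
  simp

lemma cellTrace_fe {x : Pt d} (hx : x ∈ hull T) : cellTrace T v x = cellAffine T v x := by
  rw [cellTrace_congr (g := cellAffine T v) fun y hy =>
    eq_cellAffine hΩ hv hT (interior_subset hy) (interior_hull_subset hΩ hT hy)]
  exact cellTrace_of_continuous (isFullSimplex hT) (continuous_cellAffine T v) hx

lemma cellTrace_gradient {x : Pt d} (hx : x ∈ hull T) :
    cellTrace T (gradient v) x = cellGrad T v := by
  rw [cellTrace_congr (g := fun _ => cellGrad T v) fun y hy =>
    (hasGradientAt_cell hΩ hv hT hy).gradient]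
  exact cellTrace_of_continuous (isFullSimplex hT) continuous_const hx

lemma cellTrace_laplacian {x : Pt d} (hx : x ∈ hull T) :
    cellTrace T (Laplacian.laplacian v) x = 0 := by
  rw [cellTrace_congr (g := fun _ => (0 : ℝ)) fun y hy => laplacian_cell hΩ hv hT hy]
  exact cellTrace_of_continuous (isFullSimplex hT) continuous_const hx

lemma normalDeriv_fe {x : Pt d} (hx : x ∈ hull T) (a : Pt d) :
    normalDeriv T a v x = inner ℝ (cellGrad T v) (outerNormal T a x) := by
  rw [normalDeriv, cellTrace_gradient hΩ hv hT hx]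

lemma cellGrad_smul (r : ℝ) : cellGrad T (r • v) = r • cellGrad T v := by
  have hp := (isFullSimplex hT).cellPoint_mem
  have h := (hasGradientAt_cell hΩ hv hT hp).hasFDerivAt.const_smul r
  refine HasGradientAt.gradient ?_
  rw [hasGradientAt_iff_hasFDerivAt]
  convert! h using 1
  simp

lemma cellAffine_smul (r : ℝ) (x : Pt d) :
    cellAffine T (r • v) x = r * cellAffine T v x := by
  simp only [cellAffine, cellGrad_smul hΩ hv hT, Pi.smul_apply, smul_eq_mul,
    real_inner_smul_left]
  ring

variable {w : Pt d → ℝ} (hw : w ∈ 𝓣.feSpace 1)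
include hw

lemma cellGrad_add : cellGrad T (v + w) = cellGrad T v + cellGrad T w := by
  have hp := (isFullSimplex hT).cellPoint_mem
  have h := (hasGradientAt_cell hΩ hv hT hp).hasFDerivAt.add
    (hasGradientAt_cell hΩ hw hT hp).hasFDerivAt
  refine HasGradientAt.gradient ?_
  rw [hasGradientAt_iff_hasFDerivAt]
  convert! h using 1
  simp

lemma cellAffine_add (x : Pt d) :
    cellAffine T (v + w) x = cellAffine T v x + cellAffine T w x := by
  simp only [cellAffine, cellGrad_add hΩ hv hT hw, Pi.add_apply, inner_add_left]
  ring

end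

/-- The piecewise affine functions form a finite-dimensional space. -/
lemma finiteDimensional_feSpace (hΩ : interior (closure Ω) = Ω) :
    FiniteDimensional ℝ (𝓣.feSpace 1) := by
  -- One slope and one value per cell determine the function on `Ω`; outside it is zero by
  -- normalisation.
  let L : 𝓣.feSpace 1 →ₗ[ℝ] (𝓣.cells → Pt d × ℝ) :=
    { toFun := fun v T => (cellGrad T.1 v, (v : Pt d → ℝ) (cellPoint T.1))
      map_add' := fun v w => by
        ext1 T
        simp [cellGrad_add hΩ v.2 T.2 w.2]
      map_smul' := fun r v => by
        ext1 T
        simp [cellGrad_smul hΩ v.2 T.2] }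
  refine FiniteDimensional.of_injective L ((injective_iff_map_eq_zero L).2 fun v hv => ?_)
  ext x
  by_cases hx : x ∈ Ω
  · obtain ⟨T, hT, hxT⟩ := 𝓣.mem_closure_iff.1 (subset_closure hx)
    have h := congrFun hv ⟨T, hT⟩
    simp only [L, LinearMap.coe_mk, AddHom.coe_mk, Pi.zero_apply, Prod.mk_eq_zero] at h
    rw [eq_cellAffine hΩ v.2 hT hxT hx, cellAffine, h.1, h.2]
    simp
  · exact v.2.1 x hx

end Triangulation

end

end CauchyFEM

/-! ### Surface measure of facets and the vanishing of vectors on them. -/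

namespace CauchyFEM
noncomputable section

variable {d : ℕ}

/-- A convex set of dimension less than `m` is null for the `m`-dimensional measure. -/
lemma euclideanHausdorffMeasure_eq_zero {m : ℕ} {s : Set (Pt d)} (hs : Convex ℝ s)
    (hm : Module.finrank ℝ (vectorSpan ℝ s) < m) : (μHE[m] : Measure (Pt d)) s = 0 := by
  rcases s.eq_empty_or_nonempty with rfl | hne
  · simp
  have h : dimH s < (m : NNReal) := by
    rw [Real.Convex.dimH_eq_finrank_vectorSpan hs hne]
    exact_mod_cast hm
  have := hausdorffMeasure_of_dimH_lt h
  rw [Measure.euclideanHausdorffMeasure_def]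
  simpa using Or.inr this

/-- Translation by `p` is an isometry from the direction space onto the affine span, so finiteness
and positivity of facet measures become statements about Lebesgue volume. -/
lemma euclideanHausdorffMeasure_eq_volume_preimage {s : Set (Pt d)} [Nonempty (affineSpan ℝ s)]
    (p : affineSpan ℝ s) :
    (μHE[Module.finrank ℝ (vectorSpan ℝ s)] : Measure (Pt d)) s =
      volume (IsometryEquiv.vaddConst p ⁻¹' ((↑) ⁻¹' s : Set (affineSpan ℝ s))) := by
  rw [(EuclideanGeometry.measurePreserving_vaddConst p).measure_preimage_emb
    (IsometryEquiv.vaddConst p).toHomeomorph.measurableEmbedding,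
    ← AffineSubspace.euclideanHausdorffMeasure_coe_image,
    image_preimage_eq_of_subset (fun x hx => ⟨⟨x, subset_affineSpan ℝ s hx⟩, rfl⟩),
    show Module.finrank ℝ (affineSpan ℝ s).direction = Module.finrank ℝ (vectorSpan ℝ s) from
      congrArg (fun V : Submodule ℝ (Pt d) => Module.finrank ℝ V) (direction_affineSpan ℝ s)]

lemma euclideanHausdorffMeasure_lt_top {s : Set (Pt d)} (hs : Bornology.IsBounded s) :
    (μHE[Module.finrank ℝ (vectorSpan ℝ s)] : Measure (Pt d)) s < ⊤ := by
  rcases s.eq_empty_or_nonempty with rfl | ⟨x, hx⟩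
  · simp
  have : Nonempty (affineSpan ℝ s) := ⟨⟨x, subset_affineSpan ℝ s hx⟩⟩
  rw [euclideanHausdorffMeasure_eq_volume_preimage ⟨x, subset_affineSpan ℝ s hx⟩]
  refine Bornology.IsBounded.measure_lt_top ?_
  exact ((IsometryEquiv.vaddConst _).isometry.antilipschitz.isBounded_preimage
    (isometry_subtype_coe.antilipschitz.isBounded_preimage hs))

/-- A nonempty convex set has nonempty interior relative to its affine span. -/
lemma euclideanHausdorffMeasure_pos {s : Set (Pt d)} (hs : Convex ℝ s) (hne : s.Nonempty) :
    0 < (μHE[Module.finrank ℝ (vectorSpan ℝ s)] : Measure (Pt d)) s := by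
  obtain ⟨x, hx⟩ := hne
  obtain ⟨_, y, hy, -⟩ := Set.Nonempty.intrinsicInterior hs ⟨x, hx⟩
  have : Nonempty (affineSpan ℝ s) := ⟨⟨x, subset_affineSpan ℝ s hx⟩⟩
  rw [euclideanHausdorffMeasure_eq_volume_preimage ⟨x, subset_affineSpan ℝ s hx⟩]
  refine Measure.measure_pos_of_nonempty_interior _ ?_
  rw [← IsometryEquiv.coe_toHomeomorph, ← Homeomorph.preimage_interior]
  refine ⟨(IsometryEquiv.vaddConst ⟨x, subset_affineSpan ℝ s hx⟩).symm y, ?_⟩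
  rw [mem_preimage, IsometryEquiv.coe_toHomeomorph, IsometryEquiv.apply_symm_apply]
  exact hy

/-- The direction of the affine span of a facet. -/
lemma vectorSpan_hull (s : Finset (Pt d)) :
    vectorSpan ℝ (hull s) = vectorSpan ℝ (s : Set (Pt d)) := by
  rw [← direction_affineSpan, ← direction_affineSpan, hull, affineSpan_convexHull]

lemma finrank_vectorSpan_hull {s : Finset (Pt d)} (hs : AffineIndependent ℝ ((↑) : s → Pt d))
    (hne : s.Nonempty) : Module.finrank ℝ (vectorSpan ℝ (hull s)) = s.card - 1 := by
  rw [vectorSpan_hull]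
  have := hs.finrank_vectorSpan (n := s.card - 1)
    (by rw [Fintype.card_coe]; have := hne.card_pos; omega)
  rw [← this]
  exact congrArg (fun t : Set (Pt d) => Module.finrank ℝ (vectorSpan ℝ t))
    Subtype.range_coe.symm

lemma finrank_vectorSpan_hull_le (s : Finset (Pt d)) :
    Module.finrank ℝ (vectorSpan ℝ (hull s)) ≤ s.card - 1 := by
  rw [vectorSpan_hull]
  rcases s.eq_empty_or_nonempty with rfl | hne
  · simp
  · have := finrank_vectorSpan_image_finset_le ℝ (id : Pt d → Pt d) s (n := s.card - 1)
      (by have := hne.card_pos; omega)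
    rwa [Finset.coe_image, image_id] at this

lemma orthogonal_of_const {s : Set (Pt d)} {g : Pt d} (h : ∀ x ∈ s, ∀ y ∈ s, inner ℝ g (x - y) = 0)
    {v : Pt d} (hv : v ∈ vectorSpan ℝ s) : inner ℝ g v = 0 := by
  have : vectorSpan ℝ s ≤ (ℝ ∙ g)ᗮ := by
    rw [vectorSpan_def, Submodule.span_le]
    rintro _ ⟨x, hx, y, hy, rfl⟩
    exact Submodule.mem_orthogonal_singleton_iff_inner_right.2 (h x hx y hy)
  exact Submodule.mem_orthogonal_singleton_iff_inner_right.1 (this hv)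

namespace IsFullSimplex

variable {T : Finset (Pt d)} (hT : IsFullSimplex T) {a : Pt d} (ha : a ∈ T)
include hT ha

lemma finrank_facet (hd : 2 ≤ d) :
    Module.finrank ℝ (vectorSpan ℝ (hull (T.erase a))) = d - 1 := by
  have hc : (T.erase a).card = d := by
    rw [Finset.card_erase_of_mem ha, hT.card_eq]; rfl
  rw [finrank_vectorSpan_hull (hT.indep.mono (Finset.coe_subset.2 (Finset.erase_subset _ _)))
    (Finset.card_pos.1 (by omega)), hc]

lemma facet_measure_lt_top (hd : 2 ≤ d) : (μHE[d - 1] : Measure (Pt d)) (hull (T.erase a)) < ⊤ := by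
  rw [← hT.finrank_facet ha hd]
  exact euclideanHausdorffMeasure_lt_top (isCompact_hull _).isBounded

lemma facet_measure_pos (hd : 2 ≤ d) : 0 < (μHE[d - 1] : Measure (Pt d)) (hull (T.erase a)) := by
  rw [← hT.finrank_facet ha hd]
  refine euclideanHausdorffMeasure_pos (convex_hull _) ?_
  have hc : (T.erase a).card = d := by
    rw [Finset.card_erase_of_mem ha, hT.card_eq]; rfl
  obtain ⟨b, hb⟩ := Finset.card_pos.1 (show 0 < (T.erase a).card by omega)
  exact ⟨b, mem_hull_of_mem hb⟩

/-- An affine function vanishing on a subset of positive measure of a facet is constant on the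
facet. -/
lemma inner_eq_zero_of_measure_ne_zero (hd : 2 ≤ d) {g : Pt d} {N : Set (Pt d)}
    (hN : N ⊆ hull (T.erase a)) (hNc : Convex ℝ N) (hg : ∀ x ∈ N, ∀ y ∈ N, inner ℝ g (x - y) = 0)
    (hpos : (μHE[d - 1] : Measure (Pt d)) N ≠ 0) {v : Pt d}
    (hv : v ∈ vectorSpan ℝ (hull (T.erase a))) : inner ℝ g v = 0 := by
  -- A convex set of smaller dimension would be null, so `N` spans the same directions as the facet.
  have hrank : d - 1 ≤ Module.finrank ℝ (vectorSpan ℝ N) := by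
    by_contra hcon
    exact hpos (euclideanHausdorffMeasure_eq_zero hNc (not_le.1 hcon))
  have heq : vectorSpan ℝ N = vectorSpan ℝ (hull (T.erase a)) :=
    Submodule.eq_of_le_of_finrank_le (vectorSpan_mono ℝ hN) (by rwa [hT.finrank_facet ha hd])
  exact orthogonal_of_const hg (heq ▸ hv)

omit ha in
/-- A vector orthogonal to a facet with vanishing normal component is zero. -/
lemma eq_zero_of_facet {g x : Pt d} (hx : x ∈ hull (T.erase a))
    (hg : ∀ v ∈ vectorSpan ℝ (hull (T.erase a)), inner ℝ g v = 0)
    (hn : inner ℝ g (outerNormal T a x) = 0) : g = 0 := by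
  classical
  have hK : vectorSpan ℝ (hull (T.erase a)) = vectorSpan ℝ ((T : Set (Pt d)) \ {a}) := by
    rw [vectorSpan_hull, Finset.coe_erase]
  rw [hK] at hg
  have hxa : inner ℝ g (x - a) = 0 := by
    set w : Pt d := ((vectorSpan ℝ ((T : Set (Pt d)) \ {a}))ᗮ).starProjection (x - a) with hw
    have hgw : inner ℝ g w = 0 := by
      have h : inner ℝ g (‖w‖⁻¹ • w) = 0 := hn
      -- For `w = 0` the inverse norm is zero by convention, but then `g` is trivially orthogonal to
      -- `w`.
      rw [real_inner_smul_right, mul_eq_zero, inv_eq_zero, norm_eq_zero] at h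
      rcases h with h | h
      · rw [h, inner_zero_right]
      · exact h
    have hgK : g ∈ (vectorSpan ℝ ((T : Set (Pt d)) \ {a}))ᗮ := by
      rw [Submodule.mem_orthogonal']
      exact hg
    rw [hw, ← Submodule.inner_starProjection_left_eq_right,
      Submodule.starProjection_eq_self_iff.2 hgK] at hgw
    exact hgw
  have hall : ∀ b ∈ T, inner ℝ g (b - x) = 0 := by
    intro b hb
    by_cases hba : b = a
    · rw [hba, ← neg_sub, inner_neg_right, hxa, neg_zero]
    · rw [← hK] at hg
      exact hg _ (vsub_mem_vectorSpan ℝ (mem_hull_of_mem (Finset.mem_erase.2 ⟨hba, hb⟩)) hx)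
  have hspan : vectorSpan ℝ (T : Set (Pt d)) = ⊤ := by
    have h := hT.basis.tot
    rw [hT.range_basis] at h
    rw [← direction_affineSpan, h, AffineSubspace.direction_top]
  have : inner ℝ g g = 0 := by
    refine orthogonal_of_const (s := (T : Set (Pt d))) (fun b hb c hc => ?_)
      (hspan ▸ Submodule.mem_top : g ∈ vectorSpan ℝ (T : Set (Pt d)))
    rw [← sub_sub_sub_cancel_right b c x, inner_sub_right, hall b hb, hall c hc, sub_zero]
  exact inner_self_eq_zero.1 this

omit hT ha in
/-- The outer normal is constant on a facet. -/
lemma outerNormal_eq {x y : Pt d} (hx : x ∈ hull (T.erase a)) (hy : y ∈ hull (T.erase a)) :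
    outerNormal T a x = outerNormal T a y := by
  have hK : x - y ∈ vectorSpan ℝ ((T : Set (Pt d)) \ {a}) := by
    rw [← Finset.coe_erase, ← vectorSpan_hull]
    exact vsub_mem_vectorSpan ℝ hx hy
  have h : ((vectorSpan ℝ ((T : Set (Pt d)) \ {a}))ᗮ).starProjection (x - a) =
      ((vectorSpan ℝ ((T : Set (Pt d)) \ {a}))ᗮ).starProjection (y - a) := by
    rw [← sub_eq_zero, ← map_sub, sub_sub_sub_cancel_right]
    exact Submodule.starProjection_orthogonal_apply_eq_zero hK
  simp only [outerNormal, h]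

end IsFullSimplex

lemma Triangulation.euclideanHausdorffMeasure_skeleton {Ω : Set (Pt d)} (𝓣 : Triangulation Ω)
    (hd : 2 ≤ d) : (μHE[d - 1] : Measure (Pt d)) 𝓣.skeleton = 0 := by
  refine (measure_biUnion_null_iff 𝓣.cells.countable_toSet).2 fun T _ =>
    (measure_biUnion_null_iff (Finset.countable_toSet _)).2 fun s hs => ?_
  have hs := (Finset.mem_filter.1 (Finset.mem_coe.1 hs)).2
  have := finrank_vectorSpan_hull_le s
  exact euclideanHausdorffMeasure_eq_zero (convex_hull s) (by omega)

end
end CauchyFEM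

/-! ### Integrability and bilinearity of the forms. -/

namespace CauchyFEM
noncomputable section

variable {d : ℕ}

lemma convexHull_diff_eq (T : Finset (Pt d)) (a : Pt d) :
    convexHull ℝ ((T : Set (Pt d)) \ {a}) = hull (T.erase a) := by
  rw [hull, Finset.coe_erase]

lemma IsFullSimplex.integrableOn_facet {T : Finset (Pt d)} (hT : IsFullSimplex T) {a : Pt d}
    (ha : a ∈ T) (hd : 2 ≤ d) {g g' : Pt d → ℝ} (hg' : Continuous g')
    (h : ∀ x ∈ hull (T.erase a), g x = g' x) :
    IntegrableOn g (hull (T.erase a)) μHE[d - 1] := by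
  have hm : MeasurableSet (hull (T.erase a)) := (isClosed_hull _).measurableSet
  refine IntegrableOn.congr_fun (f := g') ?_ (fun x hx => (h x hx).symm) hm
  have : IsFiniteMeasure ((μHE[d - 1] : Measure (Pt d)).restrict (hull (T.erase a))) :=
    isFiniteMeasure_restrict.2 (hT.facet_measure_lt_top ha hd).ne
  have := hg'.continuousOn.integrableOn_compact
    (μ := (μHE[d - 1] : Measure (Pt d)).restrict (hull (T.erase a)))
    (isCompact_hull (T.erase a))
  rwa [IntegrableOn, Measure.restrict_restrict hm, inter_self] at this

namespace Triangulation

variable {Ω : Set (Pt d)} {𝓣 : Triangulation Ω}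

lemma mem_interiorFaces {F : Finset (Pt d)} (hF : F ∈ 𝓣.interiorFaces) :
    ∃ T ∈ 𝓣.cells, ∃ a ∈ T, F = T.erase a := by
  simp only [interiorFaces, Finset.mem_filter, Finite.mem_toFinset] at hF
  obtain ⟨T, hT⟩ := Finset.card_pos.1 (show 0 < (𝓣.cellsOn F).card by omega)
  rw [mem_cellsOn] at hT
  have hc := (isFullSimplex hT.1).card_eq
  obtain ⟨a, ha, h⟩ := (Finset.covBy_iff_exists_insert.1
    (Finset.covBy_iff_card_sdiff_eq_one.2 ⟨hT.2, by
      rw [Finset.card_sdiff_of_subset hT.2]; omega⟩))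
  exact ⟨T, hT.1, a, h ▸ Finset.mem_insert_self _ _, by rw [← h, Finset.erase_insert ha]⟩

section Integrals

lemma boundaryIntegral_add {Γ : Set (Pt d)} (hΓ : MeasurableSet Γ)
    {g g₁ g₂ : Finset (Pt d) → Pt d → Pt d → ℝ}
    (h : ∀ T ∈ 𝓣.cells, ∀ a ∈ 𝓣.boundaryVertices T,
      IntegrableOn (g₁ T a) (convexHull ℝ ((T : Set (Pt d)) \ {a}) ∩ Γ) μHE[d - 1] ∧
      IntegrableOn (g₂ T a) (convexHull ℝ ((T : Set (Pt d)) \ {a}) ∩ Γ) μHE[d - 1] ∧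
      ∀ x ∈ hull (T.erase a), g T a x = g₁ T a x + g₂ T a x) :
    𝓣.boundaryIntegral Γ g = 𝓣.boundaryIntegral Γ g₁ + 𝓣.boundaryIntegral Γ g₂ := by
  simp only [boundaryIntegral, ← Finset.sum_add_distrib]
  refine Finset.sum_congr rfl fun T hT => Finset.sum_congr rfl fun a ha => ?_
  obtain ⟨h1, h2, h3⟩ := h T hT a ha
  rw [← integral_add h1 h2]
  rw [convexHull_diff_eq]
  exact setIntegral_congr_fun ((isClosed_hull _).measurableSet.inter hΓ) fun x hx => h3 x hx.1

lemma boundaryIntegral_smul {Γ : Set (Pt d)} (hΓ : MeasurableSet Γ) (r : ℝ)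
    {g g₁ : Finset (Pt d) → Pt d → Pt d → ℝ}
    (h : ∀ T ∈ 𝓣.cells, ∀ a ∈ 𝓣.boundaryVertices T,
      ∀ x ∈ hull (T.erase a), g T a x = r * g₁ T a x) :
    𝓣.boundaryIntegral Γ g = r * 𝓣.boundaryIntegral Γ g₁ := by
  simp only [boundaryIntegral, Finset.mul_sum]
  refine Finset.sum_congr rfl fun T hT => Finset.sum_congr rfl fun a ha => ?_
  rw [← integral_const_mul, convexHull_diff_eq]
  exact setIntegral_congr_fun ((isClosed_hull _).measurableSet.inter hΓ)
    fun x hx => h T hT a ha x hx.1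

lemma hull_erase_subset (T : Finset (Pt d)) (a : Pt d) : hull (T.erase a) ⊆ hull T :=
  hull_mono (Finset.erase_subset _ _)

/-- Almost every point of `Ω` is interior to a cell. -/
lemma ae_mem_interior (𝓣 : Triangulation Ω) (hΩm : MeasurableSet Ω) :
    ∀ᵐ x ∂(volume.restrict Ω), ∃ T ∈ 𝓣.cells, x ∈ interior (hull T) := by
  have h : ∀ᵐ x : Pt d, ∀ T ∈ 𝓣.cells, x ∉ frontier (hull T) := by
    refine (ae_ball_iff 𝓣.cells.countable_toSet).2 fun T _ => ?_
    exact measure_eq_zero_iff_ae_notMem.1 ((convex_hull T).addHaar_frontier volume)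
  filter_upwards [ae_restrict_of_ae h, ae_restrict_mem hΩm] with x hx hxΩ
  obtain ⟨T, hT, hxT⟩ := 𝓣.mem_closure_iff.1 (subset_closure hxΩ)
  refine ⟨T, hT, ?_⟩
  by_contra hcon
  exact hx T hT ⟨subset_closure hxT, hcon⟩

/-- Frontiers of convex sets are null, so open cells, where the gradients are known, suffice. -/
lemma integrableOn_of_cells {g : Pt d → ℝ}
    (h : ∀ T ∈ 𝓣.cells, IntegrableOn g (interior (hull T))) : IntegrableOn g Ω := by
  have h' : IntegrableOn g (⋃ T ∈ 𝓣.cells, hull T) := by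
    refine (integrableOn_finset_iUnion).2 fun T hT => (h T hT).congr_set_ae ?_
    refine (ae_eq_set.2 ⟨?_, by rw [sdiff_eq_empty.2 interior_subset]; simp⟩)
    rw [← (isClosed_hull T).frontier_eq]
    exact (convex_hull T).addHaar_frontier volume
  refine h'.mono_set fun x hx => ?_
  simpa using 𝓣.mem_closure_iff.1 (subset_closure hx)

end Integrals

section Linear

variable (hΩ : interior (closure Ω) = Ω) {v w : Pt d → ℝ} (hv : v ∈ 𝓣.feSpace 1)
  (hw : w ∈ 𝓣.feSpace 1)

include hΩ hv

lemma cellTrace_smul {T : Finset (Pt d)} (hT : T ∈ 𝓣.cells) {x : Pt d} (hx : x ∈ hull T)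
    (r : ℝ) : cellTrace T (r • v) x = r * cellTrace T v x := by
  rw [cellTrace_fe hΩ hv hT hx, cellTrace_fe hΩ ((𝓣.feSpace 1).smul_mem r hv) hT hx,
    cellAffine_smul hΩ hv hT]

lemma cellTrace_gradient_smul {T : Finset (Pt d)} (hT : T ∈ 𝓣.cells) {x : Pt d}
    (hx : x ∈ hull T) (r : ℝ) :
    cellTrace T (gradient (r • v)) x = r • cellTrace T (gradient v) x := by
  rw [cellTrace_gradient hΩ hv hT hx, cellTrace_gradient hΩ ((𝓣.feSpace 1).smul_mem r hv) hT hx,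
    cellGrad_smul hΩ hv hT]

lemma normalDeriv_smul {T : Finset (Pt d)} (hT : T ∈ 𝓣.cells) {x : Pt d}
    (hx : x ∈ hull T) (a : Pt d) (r : ℝ) :
    normalDeriv T a (r • v) x = r * normalDeriv T a v x := by
  rw [normalDeriv, cellTrace_gradient_smul hΩ hv hT hx, real_inner_smul_left, normalDeriv]

/-- The factor of `v` vanishes, whatever the traces of `Δu` are; for `k = 1` the `γ₂` term therefore
drops out. -/
lemma lapJumpProd_eq_zero {F : Finset (Pt d)} (u : Pt d → ℝ) {x : Pt d} (hx : x ∈ hull F) :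
    𝓣.lapJumpProd F u v x = 0 := by
  rw [lapJumpProd]
  refine mul_eq_zero_of_right _ (Finset.sum_eq_zero fun T hT => Finset.sum_eq_zero fun T' hT' => ?_)
  rw [mem_cellsOn] at hT hT'
  rw [cellTrace_laplacian hΩ hv hT.1 (hull_mono hT.2 hx),
    cellTrace_laplacian hΩ hv hT'.1 (hull_mono hT'.2 hx)]
  simp

lemma gradJumpProd_smul {F : Finset (Pt d)} (u : Pt d → ℝ) {x : Pt d} (hx : x ∈ hull F)
    (r : ℝ) : 𝓣.gradJumpProd F u (r • v) x = r * 𝓣.gradJumpProd F u v x := by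
  simp only [gradJumpProd]
  rw [mul_left_comm, Finset.mul_sum (a := r)]
  congr 1
  refine Finset.sum_congr rfl fun T hT => ?_
  rw [Finset.mul_sum]
  refine Finset.sum_congr rfl fun T' hT' => ?_
  rw [mem_cellsOn] at hT hT'
  rw [cellTrace_gradient_smul hΩ hv hT.1 (hull_mono hT.2 hx),
    cellTrace_gradient_smul hΩ hv hT'.1 (hull_mono hT'.2 hx), ← smul_sub, real_inner_smul_right]

lemma sForm_smul (γ₁ γ₂ : Finset (Pt d) → ℝ) {Γ : Set (Pt d)} (hΓ : MeasurableSet Γ)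
    (u : Pt d → ℝ) (r : ℝ) :
    𝓣.sForm γ₁ γ₂ Γ u (r • v) = r * 𝓣.sForm γ₁ γ₂ Γ u v := by
  have h1 : 𝓣.sCip γ₁ γ₂ u (r • v) = r * 𝓣.sCip γ₁ γ₂ u v := by
    simp only [sCip, Finset.mul_sum]
    refine Finset.sum_congr rfl fun F hF => ?_
    rw [← integral_const_mul]
    refine setIntegral_congr_fun (isClosed_hull F).measurableSet fun x hx => ?_
    rw [lapJumpProd_eq_zero hΩ hv u hx,
      lapJumpProd_eq_zero hΩ ((𝓣.feSpace 1).smul_mem r hv) u hx, gradJumpProd_smul hΩ hv u hx]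
    ring
  have h2 : 𝓣.sBc Γ u (r • v) = r * 𝓣.sBc Γ u v := by
    refine boundaryIntegral_smul hΓ r fun T hT a ha x hx => ?_
    have hxT := hull_erase_subset T a hx
    rw [cellTrace_smul hΩ hv hT hxT, normalDeriv_smul hΩ hv hT hxT]
    ring
  rw [sForm, h1, h2, sForm, mul_add]

include hw

lemma cellTrace_add {T : Finset (Pt d)} (hT : T ∈ 𝓣.cells) {x : Pt d} (hx : x ∈ hull T) :
    cellTrace T (v + w) x = cellTrace T v x + cellTrace T w x := by
  rw [cellTrace_fe hΩ hv hT hx, cellTrace_fe hΩ hw hT hx,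
    cellTrace_fe hΩ ((𝓣.feSpace 1).add_mem hv hw) hT hx, cellAffine_add hΩ hv hT hw]

lemma cellTrace_gradient_add {T : Finset (Pt d)} (hT : T ∈ 𝓣.cells) {x : Pt d}
    (hx : x ∈ hull T) : cellTrace T (gradient (v + w)) x =
      cellTrace T (gradient v) x + cellTrace T (gradient w) x := by
  rw [cellTrace_gradient hΩ hv hT hx, cellTrace_gradient hΩ hw hT hx,
    cellTrace_gradient hΩ ((𝓣.feSpace 1).add_mem hv hw) hT hx, cellGrad_add hΩ hv hT hw]

lemma normalDeriv_add {T : Finset (Pt d)} (hT : T ∈ 𝓣.cells) {x : Pt d} (hx : x ∈ hull T)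
    (a : Pt d) : normalDeriv T a (v + w) x = normalDeriv T a v x + normalDeriv T a w x := by
  rw [normalDeriv, cellTrace_gradient_add hΩ hv hw hT hx, inner_add_left, normalDeriv, normalDeriv]

lemma gradJumpProd_add {F : Finset (Pt d)} (u : Pt d → ℝ) {x : Pt d} (hx : x ∈ hull F) :
    𝓣.gradJumpProd F u (v + w) x = 𝓣.gradJumpProd F u v x + 𝓣.gradJumpProd F u w x := by
  simp only [gradJumpProd]
  rw [← mul_add, ← Finset.sum_add_distrib]
  congr 1
  refine Finset.sum_congr rfl fun T hT => ?_
  rw [← Finset.sum_add_distrib]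
  refine Finset.sum_congr rfl fun T' hT' => ?_
  rw [mem_cellsOn] at hT hT'
  rw [cellTrace_gradient_add hΩ hv hw hT.1 (hull_mono hT.2 hx),
    cellTrace_gradient_add hΩ hv hw hT'.1 (hull_mono hT'.2 hx), add_sub_add_comm, inner_add_right]

/-- Splitting the integrals needs each to converge, hence `StabDefined`; pulling out a scalar in
`sForm_smul` does not. -/
lemma sForm_add (γ₁ γ₂ : Finset (Pt d) → ℝ) {Γ : Set (Pt d)} (hΓ : MeasurableSet Γ)
    {u : Pt d → ℝ} (hu : 𝓣.StabDefined 1 Γ u) :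
    𝓣.sForm γ₁ γ₂ Γ u (v + w) = 𝓣.sForm γ₁ γ₂ Γ u v + 𝓣.sForm γ₁ γ₂ Γ u w := by
  have h1 : 𝓣.sCip γ₁ γ₂ u (v + w) = 𝓣.sCip γ₁ γ₂ u v + 𝓣.sCip γ₁ γ₂ u w := by
    simp only [sCip, ← Finset.sum_add_distrib]
    refine Finset.sum_congr rfl fun F hF => ?_
    have hint : ∀ z ∈ 𝓣.feSpace 1, IntegrableOn (fun x =>
        Metric.diam (hull F) * γ₁ F * 𝓣.gradJumpProd F u z x
          + Metric.diam (hull F) ^ 3 * γ₂ F * 𝓣.lapJumpProd F u z x) (hull F) μHE[d - 1] :=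
      fun z hz => (((hu z hz).1 F hF).1.const_mul _).add (((hu z hz).1 F hF).2.const_mul _)
    rw [← integral_add (hint v hv) (hint w hw)]
    refine setIntegral_congr_fun (isClosed_hull F).measurableSet fun x hx => ?_
    rw [lapJumpProd_eq_zero hΩ hv u hx, lapJumpProd_eq_zero hΩ hw u hx,
      lapJumpProd_eq_zero hΩ ((𝓣.feSpace 1).add_mem hv hw) u hx, gradJumpProd_add hΩ hv hw u hx]
    ring
  have h2 : 𝓣.sBc Γ u (v + w) = 𝓣.sBc Γ u v + 𝓣.sBc Γ u w := by
    refine boundaryIntegral_add hΓ fun T hT a ha => ⟨?_, ?_, fun x hx => ?_⟩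
    · exact (((hu v hv).2 T hT a ha).1.const_mul _).add (((hu v hv).2 T hT a ha).2.const_mul _)
    · exact (((hu w hw).2 T hT a ha).1.const_mul _).add (((hu w hw).2 T hT a ha).2.const_mul _)
    · have hxT := hull_erase_subset T a hx
      rw [cellTrace_add hΩ hv hw hT hxT, normalDeriv_add hΩ hv hw hT hxT]
      ring
  rw [sForm, h1, h2, sForm, sForm]
  ring

end Linear

lemma sForm_comm (𝓣 : Triangulation Ω) (γ₁ γ₂ : Finset (Pt d) → ℝ) (Γ : Set (Pt d))
    (u v : Pt d → ℝ) : 𝓣.sForm γ₁ γ₂ Γ u v = 𝓣.sForm γ₁ γ₂ Γ v u := by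
  simp only [sForm, sCip, sBc, gradJumpProd, lapJumpProd]
  congr 1
  · simp only [real_inner_comm, mul_comm]
  · simp only [mul_comm]

/-- Exchanging the arguments exchanges the roles of the two boundary parts, so linearity in the
first argument follows from linearity in the second. -/
lemma aForm_comm (𝓣 : Triangulation Ω) (κ : ℝ) (ΓV ΓW : Set (Pt d)) (u v : Pt d → ℝ) :
    𝓣.aForm κ ΓV ΓW u v = 𝓣.aForm κ ΓW ΓV v u := by
  simp only [aForm, real_inner_comm, mul_comm (u _)]
  ring

section Integrability

variable (hd : 2 ≤ d) (hΩ : interior (closure Ω) = Ω) {v w : Pt d → ℝ} (hv : v ∈ 𝓣.feSpace 1)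
  (hw : w ∈ 𝓣.feSpace 1)

include hΩ hv

lemma normalDeriv_eq_const {T : Finset (Pt d)} (hT : T ∈ 𝓣.cells) {a x y : Pt d}
    (hx : x ∈ hull (T.erase a)) (hy : y ∈ hull (T.erase a)) :
    normalDeriv T a v x = normalDeriv T a v y := by
  rw [normalDeriv_fe hΩ hv hT (hull_erase_subset T a hx),
    normalDeriv_fe hΩ hv hT (hull_erase_subset T a hy), IsFullSimplex.outerNormal_eq hx hy]

include hw

lemma integrableOn_inner_gradient :
    IntegrableOn (fun x => inner ℝ (gradient v x) (gradient w x)) Ω := by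
  refine integrableOn_of_cells (𝓣 := 𝓣) fun T hT => ?_
  refine IntegrableOn.congr_fun (f := fun _ => inner ℝ (cellGrad T v) (cellGrad T w)) ?_
    (fun x hx => ?_) (measurableSet_interior_hull T)
  · exact integrableOn_const
      ((measure_mono interior_subset).trans_lt (isCompact_hull T).measure_lt_top).ne
  · simp only
    rw [(hasGradientAt_cell hΩ hv hT hx).gradient, (hasGradientAt_cell hΩ hw hT hx).gradient]

lemma integrableOn_mul : IntegrableOn (fun x => v x * w x) Ω := by
  refine integrableOn_of_cells (𝓣 := 𝓣) fun T hT => ?_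
  refine IntegrableOn.congr_fun (f := fun x => cellAffine T v x * cellAffine T w x) ?_
    (fun x hx => ?_) (measurableSet_interior_hull T)
  · exact (((continuous_cellAffine T v).mul
      (continuous_cellAffine T w)).continuousOn.integrableOn_compact (isCompact_hull T)).mono_set
      interior_subset
  · have hxΩ := interior_hull_subset hΩ hT hx
    simp only
    rw [eq_cellAffine hΩ hv hT (interior_subset hx) hxΩ,
      eq_cellAffine hΩ hw hT (interior_subset hx) hxΩ]

include hd

lemma integrableOn_normalDeriv_mul (Γ : Set (Pt d)) {T : Finset (Pt d)} (hT : T ∈ 𝓣.cells)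
    {a : Pt d} (ha : a ∈ 𝓣.boundaryVertices T) :
    IntegrableOn (fun x => normalDeriv T a v x * cellTrace T w x)
      (convexHull ℝ ((T : Set (Pt d)) \ {a}) ∩ Γ) μHE[d - 1] := by
  rw [convexHull_diff_eq]
  refine IntegrableOn.mono_set ?_ inter_subset_left
  rcases (hull (T.erase a)).eq_empty_or_nonempty with he | ⟨y, hy⟩
  · simp [he]
  refine (isFullSimplex hT).integrableOn_facet (mem_boundaryVertices.1 ha).1 hd
    (g' := fun x => normalDeriv T a v y * cellAffine T w x)
    (continuous_const.mul (continuous_cellAffine T w)) fun x hx => ?_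
  rw [normalDeriv_eq_const hΩ hv hT hx hy, cellTrace_fe hΩ hw hT (hull_erase_subset T a hx)]

lemma integrableOn_facet_fe (Γ : Set (Pt d)) {T : Finset (Pt d)} (hT : T ∈ 𝓣.cells)
    {a : Pt d} (ha : a ∈ 𝓣.boundaryVertices T) :
    IntegrableOn (fun x => cellTrace T v x * cellTrace T w x)
      (convexHull ℝ ((T : Set (Pt d)) \ {a}) ∩ Γ) μHE[d - 1] ∧
    IntegrableOn (fun x => normalDeriv T a v x * normalDeriv T a w x)
      (convexHull ℝ ((T : Set (Pt d)) \ {a}) ∩ Γ) μHE[d - 1] := by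
  rw [convexHull_diff_eq]
  constructor
  · refine IntegrableOn.mono_set ?_ inter_subset_left
    refine (isFullSimplex hT).integrableOn_facet (mem_boundaryVertices.1 ha).1 hd
      (g' := fun x => cellAffine T v x * cellAffine T w x) ((continuous_cellAffine T v).mul (continuous_cellAffine T w)) fun x hx => ?_
    rw [cellTrace_fe hΩ hv hT (hull_erase_subset T a hx),
      cellTrace_fe hΩ hw hT (hull_erase_subset T a hx)]
  · refine IntegrableOn.mono_set ?_ inter_subset_left
    rcases (hull (T.erase a)).eq_empty_or_nonempty with he | ⟨y, hy⟩
    · simp [he]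
    refine (isFullSimplex hT).integrableOn_facet (mem_boundaryVertices.1 ha).1 hd
      (g' := fun _ => normalDeriv T a v y * normalDeriv T a w y) continuous_const fun x hx => ?_
    rw [normalDeriv_eq_const hΩ hv hT hx hy, normalDeriv_eq_const hΩ hw hT hx hy]

omit hw

/-- The stabilisation is well defined for piecewise affine functions. -/
lemma stabDefined (Γ : Set (Pt d)) : 𝓣.StabDefined 1 Γ v := by
  refine fun w hw => ⟨fun F hF => ?_, fun T hT a ha => integrableOn_facet_fe hd hΩ hv hw Γ hT ha⟩
  obtain ⟨T, hT, a, ha, rfl⟩ := mem_interiorFaces hF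
  constructor
  · refine (isFullSimplex hT).integrableOn_facet ha hd
      (g' := fun _ => 1 / 2 * ∑ S ∈ 𝓣.cellsOn (T.erase a), ∑ S' ∈ 𝓣.cellsOn (T.erase a),
        inner ℝ (cellGrad S v - cellGrad S' v) (cellGrad S w - cellGrad S' w))
      continuous_const fun x hx => ?_
    rw [gradJumpProd]
    congr 1
    refine Finset.sum_congr rfl fun S hS => Finset.sum_congr rfl fun S' hS' => ?_
    rw [mem_cellsOn] at hS hS'
    have h1 := hull_mono hS.2 hx
    have h2 := hull_mono hS'.2 hx
    rw [cellTrace_gradient hΩ hv hS.1 h1, cellTrace_gradient hΩ hv hS'.1 h2,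
      cellTrace_gradient hΩ hw hS.1 h1, cellTrace_gradient hΩ hw hS'.1 h2]
  · exact (isFullSimplex hT).integrableOn_facet ha hd (g' := fun _ => 0) continuous_const
      fun x hx => lapJumpProd_eq_zero hΩ hw v hx

end Integrability

section AForm

variable (hd : 2 ≤ d) (hΩ : interior (closure Ω) = Ω) {u v w : Pt d → ℝ} (hu : u ∈ 𝓣.feSpace 1)
  (hv : v ∈ 𝓣.feSpace 1) (hw : w ∈ 𝓣.feSpace 1) (κ : ℝ) {ΓV ΓW : Set (Pt d)}
  (hΓV : MeasurableSet ΓV) (hΓW : MeasurableSet ΓW)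

include hΩ hv hΓV hΓW

lemma aForm_smul (u : Pt d → ℝ) (r : ℝ) :
    𝓣.aForm κ ΓV ΓW u (r • v) = r * 𝓣.aForm κ ΓV ΓW u v := by
  have hΩm : MeasurableSet Ω := (hΩ ▸ isOpen_interior : IsOpen Ω).measurableSet
  have h1 : ∫ x in Ω, inner ℝ (gradient u x) (gradient (r • v) x) =
      r * ∫ x in Ω, inner ℝ (gradient u x) (gradient v x) := by
    rw [← integral_const_mul]
    refine integral_congr_ae ?_
    filter_upwards [𝓣.ae_mem_interior hΩm] with x ⟨T, hT, hx⟩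
    rw [(hasGradientAt_cell hΩ hv hT hx).gradient,
      (hasGradientAt_cell hΩ ((𝓣.feSpace 1).smul_mem r hv) hT hx).gradient,
      cellGrad_smul hΩ hv hT, real_inner_smul_right]
  have h2 : ∫ x in Ω, u x * (r • v) x = r * ∫ x in Ω, u x * v x := by
    rw [← integral_const_mul]
    congr 1
    ext x
    simp only [Pi.smul_apply, smul_eq_mul]; ring
  have h3 : 𝓣.boundaryIntegral ΓV (fun T a x => normalDeriv T a (r • v) x * cellTrace T u x) =
      r * 𝓣.boundaryIntegral ΓV (fun T a x => normalDeriv T a v x * cellTrace T u x) := by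
    refine boundaryIntegral_smul hΓV r fun T hT a ha x hx => ?_
    rw [normalDeriv_smul hΩ hv hT (hull_erase_subset T a hx)]
    ring
  have h4 : 𝓣.boundaryIntegral ΓW (fun T a x => normalDeriv T a u x * cellTrace T (r • v) x) =
      r * 𝓣.boundaryIntegral ΓW (fun T a x => normalDeriv T a u x * cellTrace T v x) := by
    refine boundaryIntegral_smul hΓW r fun T hT a ha x hx => ?_
    rw [cellTrace_smul hΩ hv hT (hull_erase_subset T a hx)]
    ring
  rw [aForm, h1, h2, h3, h4, aForm]
  ring

include hd hu hw

lemma aForm_add : 𝓣.aForm κ ΓV ΓW u (v + w) = 𝓣.aForm κ ΓV ΓW u v + 𝓣.aForm κ ΓV ΓW u w := by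
  have hΩm : MeasurableSet Ω := (hΩ ▸ isOpen_interior : IsOpen Ω).measurableSet
  have h1 : ∫ x in Ω, inner ℝ (gradient u x) (gradient (v + w) x) =
      (∫ x in Ω, inner ℝ (gradient u x) (gradient v x)) +
        ∫ x in Ω, inner ℝ (gradient u x) (gradient w x) := by
    rw [← integral_add (integrableOn_inner_gradient hΩ hu hv)
      (integrableOn_inner_gradient hΩ hu hw)]
    refine integral_congr_ae ?_
    filter_upwards [𝓣.ae_mem_interior hΩm] with x ⟨T, hT, hx⟩
    rw [(hasGradientAt_cell hΩ hv hT hx).gradient, (hasGradientAt_cell hΩ hw hT hx).gradient,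
      (hasGradientAt_cell hΩ ((𝓣.feSpace 1).add_mem hv hw) hT hx).gradient,
      cellGrad_add hΩ hv hT hw, inner_add_right]
  have h2 : ∫ x in Ω, u x * (v + w) x = (∫ x in Ω, u x * v x) + ∫ x in Ω, u x * w x := by
    rw [← integral_add (integrableOn_mul hΩ hu hv) (integrableOn_mul hΩ hu hw)]
    congr 1
    ext x
    simp only [Pi.add_apply]; ring
  have h3 : 𝓣.boundaryIntegral ΓV (fun T a x => normalDeriv T a (v + w) x * cellTrace T u x) =
      𝓣.boundaryIntegral ΓV (fun T a x => normalDeriv T a v x * cellTrace T u x) +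
      𝓣.boundaryIntegral ΓV (fun T a x => normalDeriv T a w x * cellTrace T u x) := by
    refine boundaryIntegral_add hΓV fun T hT a ha =>
      ⟨integrableOn_normalDeriv_mul hd hΩ hv hu ΓV hT ha,
        integrableOn_normalDeriv_mul hd hΩ hw hu ΓV hT ha, fun x hx => ?_⟩
    rw [normalDeriv_add hΩ hv hw hT (hull_erase_subset T a hx)]
    ring
  have h4 : 𝓣.boundaryIntegral ΓW (fun T a x => normalDeriv T a u x * cellTrace T (v + w) x) =
      𝓣.boundaryIntegral ΓW (fun T a x => normalDeriv T a u x * cellTrace T v x) +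
      𝓣.boundaryIntegral ΓW (fun T a x => normalDeriv T a u x * cellTrace T w x) := by
    refine boundaryIntegral_add hΓW fun T hT a ha =>
      ⟨integrableOn_normalDeriv_mul hd hΩ hu hv ΓW hT ha,
        integrableOn_normalDeriv_mul hd hΩ hu hw ΓW hT ha, fun x hx => ?_⟩
    rw [cellTrace_add hΩ hv hw hT (hull_erase_subset T a hx)]
    ring
  rw [aForm, h1, h2, h3, h4, aForm, aForm]
  ring

end AForm

end Triangulation

end
end CauchyFEM

/-! ### Nonnegativity and definiteness of the stabilisation. -/

namespace CauchyFEM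
noncomputable section

variable {d : ℕ}

namespace Triangulation

variable {Ω : Set (Pt d)} {𝓣 : Triangulation Ω}

section Positivity

lemma diam_hull_pos {s : Finset (Pt d)} (hs : 1 < s.card) : 0 < Metric.diam (hull s) := by
  obtain ⟨a, ha, b, hb, hab⟩ := Finset.one_lt_card.1 hs
  exact (dist_pos.2 hab).trans_le (Metric.dist_le_diam_of_mem (isCompact_hull s).isBounded
    (mem_hull_of_mem ha) (mem_hull_of_mem hb))

lemma meshSize_pos (𝓣 : Triangulation Ω) (hne : Ω.Nonempty) (hd : 0 < d) : 0 < 𝓣.meshSize := by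
  obtain ⟨x, hx⟩ := hne
  obtain ⟨T, hT, -⟩ := 𝓣.mem_closure_iff.1 (subset_closure hx)
  refine (diam_hull_pos (s := T) (by rw [(isFullSimplex hT).card_eq]; omega)).trans_le ?_
  exact le_csSup (𝓣.cells.finite_toSet.image _).bddAbove ⟨T, hT, rfl⟩

variable (hd : 2 ≤ d) (hΩ : interior (closure Ω) = Ω) (hconn : IsConnected Ω)
  {γ₁ γ₂ : Finset (Pt d) → ℝ} (hγ₁ : ∀ F ∈ 𝓣.interiorFaces, 0 < γ₁ F)
  {v : Pt d → ℝ} (hv : v ∈ 𝓣.feSpace 1)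

include hΩ hv in
-- The right side does not depend on `x`, so a vanishing face integral forces the jumps themselves
-- to vanish.
lemma sCip_integrand_eq {F : Finset (Pt d)} {x : Pt d} (hx : x ∈ hull F) :
    Metric.diam (hull F) * γ₁ F * 𝓣.gradJumpProd F v v x
      + Metric.diam (hull F) ^ 3 * γ₂ F * 𝓣.lapJumpProd F v v x =
    Metric.diam (hull F) * γ₁ F * (1 / 2 * ∑ T ∈ 𝓣.cellsOn F, ∑ T' ∈ 𝓣.cellsOn F,
      ‖cellGrad T v - cellGrad T' v‖ ^ 2) := by
  rw [lapJumpProd_eq_zero hΩ hv v hx, mul_zero, add_zero, gradJumpProd]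
  congr 2
  refine Finset.sum_congr rfl fun S hS => Finset.sum_congr rfl fun S' hS' => ?_
  rw [mem_cellsOn] at hS hS'
  rw [cellTrace_gradient hΩ hv hS.1 (hull_mono hS.2 hx),
    cellTrace_gradient hΩ hv hS'.1 (hull_mono hS'.2 hx), real_inner_self_eq_norm_sq]

include hΩ hv hγ₁

lemma sCip_self_summand_nonneg {F : Finset (Pt d)} (hF : F ∈ 𝓣.interiorFaces) :
    0 ≤ ∫ x in hull F, (Metric.diam (hull F) * γ₁ F * 𝓣.gradJumpProd F v v x
      + Metric.diam (hull F) ^ 3 * γ₂ F * 𝓣.lapJumpProd F v v x) ∂μHE[d - 1] := by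
  refine setIntegral_nonneg (isClosed_hull F).measurableSet fun x hx => ?_
  rw [sCip_integrand_eq hΩ hv hx]
  have := hγ₁ F hF
  have := Metric.diam_nonneg (s := hull F)
  positivity

lemma sCip_self_nonneg : 0 ≤ 𝓣.sCip γ₁ γ₂ v v :=
  Finset.sum_nonneg fun _ hF => sCip_self_summand_nonneg hΩ hγ₁ hv hF

include hd

/-- If the interior penalty vanishes, the gradient has no jumps. -/
lemma cellGrad_eq_of_sCip_eq_zero (h : 𝓣.sCip γ₁ γ₂ v v = 0) {F : Finset (Pt d)}
    (hF : F ∈ 𝓣.interiorFaces) {T T' : Finset (Pt d)} (hT : T ∈ 𝓣.cellsOn F)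
    (hT' : T' ∈ 𝓣.cellsOn F) : cellGrad T v = cellGrad T' v := by
  have h0 := (Finset.sum_eq_zero_iff_of_nonneg fun F hF =>
    sCip_self_summand_nonneg (γ₂ := γ₂) hΩ hγ₁ hv hF).1 h F hF
  rw [setIntegral_congr_fun (isClosed_hull F).measurableSet
    fun x hx => sCip_integrand_eq (γ₁ := γ₁) (γ₂ := γ₂) hΩ hv hx, setIntegral_const,
    smul_eq_mul, mul_eq_zero, mul_eq_zero] at h0
  have hγ := hγ₁ F hF
  obtain ⟨K, hK, a, ha, rfl⟩ := mem_interiorFaces hF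
  have hKF := isFullSimplex hK
  have hcard : (K.erase a).card = d := by
    rw [Finset.card_erase_of_mem ha, hKF.card_eq]; rfl
  have hdiam := diam_hull_pos (s := K.erase a) (by omega)
  -- Finiteness matters as well as positivity, since `toReal` sends infinite measure to zero.
  have hμ : (μHE[d - 1] : Measure (Pt d)).real (hull (K.erase a)) ≠ 0 :=
    (ENNReal.toReal_pos (hKF.facet_measure_pos ha hd).ne' (hKF.facet_measure_lt_top ha hd).ne).ne'
  have hsum := (h0.resolve_left hμ).resolve_left (mul_pos hdiam hγ).ne'
  have h1 := (mul_eq_zero.1 hsum).resolve_left (by norm_num)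
  have h2 := (Finset.sum_eq_zero_iff_of_nonneg fun S _ => Finset.sum_nonneg fun S' _ =>
    sq_nonneg ‖cellGrad S v - cellGrad S' v‖).1 h1 T hT
  have h3 := (Finset.sum_eq_zero_iff_of_nonneg fun S' _ =>
    sq_nonneg ‖cellGrad T v - cellGrad S' v‖).1 h2 T' hT'
  rwa [sq_eq_zero_iff, norm_eq_zero, sub_eq_zero] at h3

omit hd hΩ hv hγ₁

lemma sBc_integrand_nonneg (hh : 0 < 𝓣.meshSize) (T : Finset (Pt d)) (a x : Pt d) :
    0 ≤ 𝓣.meshSize⁻¹ * (cellTrace T v x * cellTrace T v x)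
        + 𝓣.meshSize * (normalDeriv T a v x * normalDeriv T a v x) :=
  add_nonneg (mul_nonneg (inv_pos.2 hh).le (mul_self_nonneg _))
    (mul_nonneg hh.le (mul_self_nonneg _))

lemma sBc_self_summand_nonneg {Γ : Set (Pt d)} (hh : 0 < 𝓣.meshSize) (T : Finset (Pt d))
    (a : Pt d) : 0 ≤ ∫ x in convexHull ℝ ((T : Set (Pt d)) \ {a}) ∩ Γ,
      (𝓣.meshSize⁻¹ * (cellTrace T v x * cellTrace T v x)
        + 𝓣.meshSize * (normalDeriv T a v x * normalDeriv T a v x)) ∂μHE[d - 1] := by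
  exact integral_nonneg fun x => sBc_integrand_nonneg hh T a x

lemma sBc_self_nonneg {Γ : Set (Pt d)} (hh : 0 < 𝓣.meshSize) : 0 ≤ 𝓣.sBc Γ v v :=
  Finset.sum_nonneg fun T _ => Finset.sum_nonneg fun a _ => sBc_self_summand_nonneg hh T a

/-- A subset of the boundary of positive surface measure charges some boundary face. -/
lemma exists_boundaryFace_measure_ne_zero (𝓣 : Triangulation Ω) (hd : 2 ≤ d)
    (hΩ : interior (closure Ω) = Ω) {Γ : Set (Pt d)}
    (hΓ : Γ ⊆ frontier Ω) (hpos : 0 < (μHE[d - 1] : Measure (Pt d)) Γ) :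
    ∃ T ∈ 𝓣.cells, ∃ a ∈ 𝓣.boundaryVertices T,
      (μHE[d - 1] : Measure (Pt d)) (hull (T.erase a) ∩ Γ) ≠ 0 := by
  by_contra hcon
  push Not at hcon
  refine hpos.ne' (measure_mono_null (t := 𝓣.skeleton ∪
    ⋃ T ∈ 𝓣.cells, ⋃ a ∈ 𝓣.boundaryVertices T, hull (T.erase a) ∩ Γ) (fun x hx => ?_) ?_)
  · by_cases hxs : x ∈ 𝓣.skeleton
    · exact Or.inl hxs
    · obtain ⟨T, hT, a, ha, hxa⟩ := 𝓣.exists_boundaryFace hΩ (hΓ hx) hxs (by omega)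
      exact Or.inr (mem_biUnion hT (mem_biUnion ha ⟨hxa, hx⟩))
  · refine measure_union_null (𝓣.euclideanHausdorffMeasure_skeleton hd) ?_
    refine (measure_biUnion_null_iff 𝓣.cells.countable_toSet).2 fun T hT =>
      (measure_biUnion_null_iff (Finset.countable_toSet _)).2 fun a ha => hcon T hT a ha

include hd hΩ hv

/-- If the boundary penalty vanishes, so does the function on some cell. -/
lemma exists_cell_of_sBc_eq_zero {Γ : Set (Pt d)} (hΓ : Γ ⊆ frontier Ω) (hΓm : MeasurableSet Γ)
    (hpos : 0 < (μHE[d - 1] : Measure (Pt d)) Γ) (hh : 0 < 𝓣.meshSize)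
    (h : 𝓣.sBc Γ v v = 0) : ∃ T ∈ 𝓣.cells, cellGrad T v = 0 ∧ v (cellPoint T) = 0 := by
  obtain ⟨T, hT, a, ha, hμ⟩ := 𝓣.exists_boundaryFace_measure_ne_zero hd hΩ hΓ hpos
  have hF := isFullSimplex hT
  have haT := (mem_boundaryVertices.1 ha).1
  have h0 := (Finset.sum_eq_zero_iff_of_nonneg fun a _ =>
    sBc_self_summand_nonneg hh T a).1 ((Finset.sum_eq_zero_iff_of_nonneg fun T _ =>
      Finset.sum_nonneg fun a _ => sBc_self_summand_nonneg hh T a).1 h T hT) a ha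
  obtain ⟨hi1, hi2⟩ := integrableOn_facet_fe hd hΩ hv hv Γ hT ha
  have hae := (integral_eq_zero_iff_of_nonneg (fun x => sBc_integrand_nonneg hh T a x)
    ((hi1.const_mul _).add (hi2.const_mul _))).1 h0
  rw [convexHull_diff_eq] at hae
  have hBm : MeasurableSet (hull (T.erase a) ∩ Γ) := (isClosed_hull _).measurableSet.inter hΓm
  have hzero : ∀ᵐ x ∂((μHE[d - 1] : Measure (Pt d)).restrict (hull (T.erase a) ∩ Γ)),
      x ∈ hull (T.erase a) ∧ cellAffine T v x = 0 ∧
        inner ℝ (cellGrad T v) (outerNormal T a x) = 0 := by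
    filter_upwards [hae, ae_restrict_mem hBm] with x hx hxB
    have hxT := hull_erase_subset T a hxB.1
    have h1 := mul_self_nonneg (cellTrace T v x)
    have h2 := mul_self_nonneg (normalDeriv T a v x)
    simp only [Pi.zero_apply] at hx
    have hinv : 0 < 𝓣.meshSize⁻¹ := inv_pos.2 hh
    have hx' := (add_eq_zero_iff_of_nonneg (mul_nonneg hinv.le h1) (mul_nonneg hh.le h2)).1 hx
    refine ⟨hxB.1, ?_, ?_⟩
    · rw [← cellTrace_fe hΩ hv hT hxT]
      exact mul_self_eq_zero.1 ((mul_eq_zero.1 hx'.1).resolve_left hinv.ne')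
    · rw [← normalDeriv_fe hΩ hv hT hxT]
      exact mul_self_eq_zero.1 ((mul_eq_zero.1 hx'.2).resolve_left hh.ne')
  -- The zero set in the whole facet contains almost all of the facet's part in `Γ`. Unlike that
  -- part it is convex, which the dimension argument requires.
  have hN : (μHE[d - 1] : Measure (Pt d)) (hull (T.erase a) ∩ {x | cellAffine T v x = 0}) ≠ 0 := by
    intro hN0
    refine hμ (measure_mono_null (t := (hull (T.erase a) ∩ {x | cellAffine T v x = 0}) ∪
      ((hull (T.erase a) ∩ Γ) \ {x | cellAffine T v x = 0})) (fun x hx => ?_)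
      (measure_union_null hN0 ?_))
    · by_cases hx0 : cellAffine T v x = 0
      · exact Or.inl ⟨hx.1, hx0⟩
      · exact Or.inr ⟨hx, hx0⟩
    · have := ae_iff.1 ((ae_restrict_iff' hBm).1 hzero)
      refine measure_mono_null (fun x hx => ?_) this
      exact fun hcon => hx.2 (hcon hx.1).2.1
  have hneBot : (ae ((μHE[d - 1] : Measure (Pt d)).restrict (hull (T.erase a) ∩ Γ))).NeBot := by
    rw [ae_neBot]
    exact fun hcon => hμ (Measure.restrict_eq_zero.1 hcon)
  -- One point suffices for the normal component and, once the gradient is zero, for the value.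
  obtain ⟨x, hx, hx0, hxn⟩ := hzero.exists
  have hconv : Convex ℝ (hull (T.erase a) ∩ {x | cellAffine T v x = 0}) := by
    refine (convex_hull _).inter fun y hy z hz s t _ _ hst => ?_
    simp only [mem_ofPred_eq, cellAffine] at hy hz ⊢
    have ht : t = 1 - s := by linarith
    subst ht
    simp only [inner_sub_right, inner_add_right, real_inner_smul_right] at hy hz ⊢
    linear_combination s * hy + (1 - s) * hz
  have hg : cellGrad T v = 0 := by
    refine hF.eq_zero_of_facet hx (fun y hy => ?_) hxn
    refine hF.inner_eq_zero_of_measure_ne_zero haT hd inter_subset_left hconv ?_ hN hy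
    intro y hy z hz
    have := cellAffine_add_inner T v z y
    have hy0 : cellAffine T v y = 0 := hy.2
    have hz0 : cellAffine T v z = 0 := hz.2
    rw [hy0, hz0] at this
    linarith
  refine ⟨T, hT, hg, ?_⟩
  rw [cellAffine, hg, inner_zero_left, add_zero] at hx0
  exact hx0

include hconn hγ₁

lemma sForm_self_nonneg {Γ : Set (Pt d)} : 0 ≤ 𝓣.sForm γ₁ γ₂ Γ v v :=
  add_nonneg (sCip_self_nonneg hΩ hγ₁ hv)
    (sBc_self_nonneg (𝓣.meshSize_pos hconn.nonempty (by omega)))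

/-- The stabilisation is definite on the piecewise affine functions. -/
lemma eq_zero_of_sForm_self {Γ : Set (Pt d)} (hΓ : Γ ⊆ frontier Ω) (hΓm : MeasurableSet Γ)
    (hpos : 0 < (μHE[d - 1] : Measure (Pt d)) Γ) (h : 𝓣.sForm γ₁ γ₂ Γ v v = 0) : v = 0 := by
  have hh := 𝓣.meshSize_pos hconn.nonempty (by omega)
  obtain ⟨h1, h2⟩ := (add_eq_zero_iff_of_nonneg (sCip_self_nonneg hΩ hγ₁ hv)
    (sBc_self_nonneg hh)).1 h
  obtain ⟨T₀, hT₀, hg₀, hc₀⟩ := exists_cell_of_sBc_eq_zero hd hΩ hv hΓ hΓm hpos hh h2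
  have hg : ∀ T ∈ 𝓣.cells, cellGrad T v = 0 := fun T hT => by
    rw [← hg₀]
    exact eq_of_interiorFaces hΩ hconn (by omega) (φ := fun T => cellGrad T v)
      (fun F hF S hS S' hS' => cellGrad_eq_of_sCip_eq_zero hd hΩ hγ₁ hv h1 hF hS hS') hT hT₀
  have hval : ∀ T ∈ 𝓣.cells, ∀ x ∈ hull T, x ∈ Ω → v x = v (cellPoint T) := fun T hT x hx hxΩ => by
    rw [eq_cellAffine hΩ hv hT hx hxΩ, cellAffine, hg T hT, inner_zero_left, add_zero]
  have hmeet : ∀ T ∈ 𝓣.cells, (Ω ∩ hull T).Nonempty := fun T hT =>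
    ⟨_, interior_hull_subset hΩ hT (isFullSimplex hT).cellPoint_mem,
      interior_subset (isFullSimplex hT).cellPoint_mem⟩
  ext x
  by_cases hx : x ∈ Ω
  · obtain ⟨T, hT, hxT⟩ := 𝓣.mem_closure_iff.1 (subset_closure hx)
    rw [hval T hT x hxT hx, Pi.zero_apply, ← hc₀]
    -- With zero slopes `v` is constant on the part of each cell in `Ω`; two cells meeting at a
    -- point of `Ω` share its value.
    refine eq_of_isPreconnected hconn.isPreconnected subset_closure
      (φ := fun T => v (cellPoint T)) ?_ hT hT₀ (hmeet T hT) (hmeet T₀ hT₀)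
    intro y hy S hS S' hS' hyS hyS'
    rw [← hval S hS y hyS hy, ← hval S' hS' y hyS' hy]
  · exact hv.1 x hx

end Positivity

/-- The product of a square integrable function and a finite element function is integrable. -/
lemma integrableOn_load (hΩ : interior (closure Ω) = Ω) {f : Pt d → ℝ}
    (hf : MemLp f 2 (volume.restrict Ω)) {w : Pt d → ℝ} (hw : w ∈ 𝓣.feSpace 1) :
    IntegrableOn (fun x => f x * w x) Ω := by
  have hΩm : MeasurableSet Ω := (hΩ ▸ isOpen_interior : IsOpen Ω).measurableSet
  have hw2 : MemLp w 2 (volume.restrict Ω) :=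
    (memLp_two_iff_integrable_sq (hw.2.1.aestronglyMeasurable hΩm)).2 (by
      simp only [sq]; exact integrableOn_mul hΩ hw hw)
  exact hf.integrable_mul hw2

end Triangulation

end

end CauchyFEM

/-! ### Unique solvability of the discrete system. -/

open CauchyFEM CauchyFEM.Triangulation in
theorem mainTheorem10 (d : ℕ) (hd : d = 2 ∨ d = 3)
    (Ω : Set (CauchyFEM.Pt d)) (hΩ_conn : IsConnected Ω) (hΩ_reg : interior (closure Ω) = Ω)
    (𝓣 : CauchyFEM.Triangulation Ω)
    (ΓV ΓW : Set (CauchyFEM.Pt d)) (hΓ : CauchyFEM.IsCauchySplitting Ω ΓV ΓW)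
    (κ : ℝ) (γ₁ γ₂ : Finset (CauchyFEM.Pt d) → ℝ)
    (hγ₁ : ∀ F ∈ 𝓣.interiorFaces, 0 < γ₁ F) (hγ₂ : ∀ F ∈ 𝓣.interiorFaces, 0 < γ₂ F)
    (f : CauchyFEM.Pt d → ℝ) (hf : MemLp f 2 (volume.restrict Ω))
    (u : CauchyFEM.Pt d → ℝ) (hu : 𝓣.StabDefined 1 ΓV u) :
    ∃! p : 𝓣.feSpace 1 × 𝓣.feSpace 1,
      𝓣.IsFEMSolution 1 κ γ₁ γ₂ ΓV ΓW f u p.1 p.2 := by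
  have hd2 : 2 ≤ d := by omega
  have hmV := hΓ.measurable_V
  have hmW := hΓ.measurable_W
  have hfin : FiniteDimensional ℝ (𝓣.feSpace 1) := finiteDimensional_feSpace hΩ_reg
  let A : 𝓣.feSpace 1 →ₗ[ℝ] 𝓣.feSpace 1 →ₗ[ℝ] ℝ :=
    LinearMap.mk₂ ℝ (fun v w => 𝓣.aForm κ ΓV ΓW v w)
      (fun v v' w => by
        simp only [aForm_comm 𝓣 κ ΓV ΓW]
        exact aForm_add hd2 hΩ_reg w.2 v.2 v'.2 κ hmW hmV)
      (fun r v w => by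
        simp only [aForm_comm 𝓣 κ ΓV ΓW]
        exact aForm_smul hΩ_reg v.2 κ hmW hmV w r)
      (fun v w w' => aForm_add hd2 hΩ_reg v.2 w.2 w'.2 κ hmV hmW)
      (fun r v w => aForm_smul hΩ_reg w.2 κ hmV hmW v r)
  let S : ∀ Γ : Set (Pt d), MeasurableSet Γ → 𝓣.feSpace 1 →ₗ[ℝ] 𝓣.feSpace 1 →ₗ[ℝ] ℝ :=
    fun Γ hm => LinearMap.mk₂ ℝ (fun v w => 𝓣.sForm γ₁ γ₂ Γ v w)
      (fun v v' w => by
        simp only [sForm_comm 𝓣 γ₁ γ₂ Γ _ w]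
        exact sForm_add hΩ_reg v.2 v'.2 γ₁ γ₂ hm (stabDefined hd2 hΩ_reg w.2 Γ))
      (fun r v w => by
        simp only [sForm_comm 𝓣 γ₁ γ₂ Γ _ w]
        exact sForm_smul hΩ_reg v.2 γ₁ γ₂ hm w r)
      (fun v w w' => sForm_add hΩ_reg w.2 w'.2 γ₁ γ₂ hm (stabDefined hd2 hΩ_reg v.2 Γ))
      (fun r v w => sForm_smul hΩ_reg w.2 γ₁ γ₂ hm v r)
  let load : 𝓣.feSpace 1 →ₗ[ℝ] ℝ :=
    { toFun := fun w => ∫ x in Ω, f x * (w : Pt d → ℝ) x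
      map_add' := fun w w' => by
        rw [← integral_add (integrableOn_load hΩ_reg hf w.2) (integrableOn_load hΩ_reg hf w'.2)]
        simp [mul_add]
      map_smul' := fun r w => by
        rw [RingHom.id_apply, smul_eq_mul, ← integral_const_mul]
        simp [mul_left_comm] }
  let data : 𝓣.feSpace 1 →ₗ[ℝ] ℝ :=
    { toFun := fun v => - 𝓣.sForm γ₁ γ₂ ΓV u v
      map_add' := fun v v' => by
        rw [Submodule.coe_add, sForm_add hΩ_reg v.2 v'.2 γ₁ γ₂ hmV hu, neg_add]
      map_smul' := fun r v => by
        rw [Submodule.coe_smul, sForm_smul hΩ_reg v.2 γ₁ γ₂ hmV u r]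
        simp }
  -- The block operator sends `(u, z)` to the functionals `a_h(u, ·) + s_a(z, ·)` and `-s_p(u, ·) +
  -- a_h(·, z)`.
  let Φ : (𝓣.feSpace 1 × 𝓣.feSpace 1) →ₗ[ℝ]
      (Module.Dual ℝ (𝓣.feSpace 1) × Module.Dual ℝ (𝓣.feSpace 1)) :=
    (A.coprod (S ΓW hmW)).prod ((-S ΓV hmV).coprod A.flip)
  have hinj : Function.Injective Φ := by
    refine (injective_iff_map_eq_zero Φ).2 fun p hp => ?_
    have h1 : 𝓣.aForm κ ΓV ΓW p.1 p.2 + 𝓣.sForm γ₁ γ₂ ΓW p.2 p.2 = 0 :=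
      LinearMap.congr_fun (congrArg Prod.fst hp) p.2
    have h2 : - 𝓣.sForm γ₁ γ₂ ΓV p.1 p.1 + 𝓣.aForm κ ΓV ΓW p.1 p.2 = 0 :=
      LinearMap.congr_fun (congrArg Prod.snd hp) p.1
    have n1 := sForm_self_nonneg (γ₂ := γ₂) hd2 hΩ_reg hΩ_conn hγ₁ p.1.2 (Γ := ΓV)
    have n2 := sForm_self_nonneg (γ₂ := γ₂) hd2 hΩ_reg hΩ_conn hγ₁ p.2.2 (Γ := ΓW)
    -- `h1` minus `h2` says that the two nonnegative stabilisation terms sum to zero.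
    have z1 := eq_zero_of_sForm_self (γ₂ := γ₂) hd2 hΩ_reg hΩ_conn hγ₁ p.1.2 hΓ.subset_V hmV
      hΓ.measure_pos_V (by linarith)
    have z2 := eq_zero_of_sForm_self (γ₂ := γ₂) hd2 hΩ_reg hΩ_conn hγ₁ p.2.2 hΓ.subset_W hmW
      hΓ.measure_pos_W (by linarith)
    exact Prod.ext (Subtype.ext z1) (Subtype.ext z2)
  have hsurj : Function.Surjective Φ :=
    (LinearMap.injective_iff_surjective_of_finrank_eq_finrank (by
      simp [Module.finrank_prod, Subspace.dual_finrank_eq])).1 hinj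
  have hiff : ∀ p : 𝓣.feSpace 1 × 𝓣.feSpace 1,
      𝓣.IsFEMSolution 1 κ γ₁ γ₂ ΓV ΓW f u p.1 p.2 ↔ Φ p = (load, data) := by
    intro p
    have e1 : ∀ w : 𝓣.feSpace 1, (Φ p).1 w =
        𝓣.aForm κ ΓV ΓW p.1 w + 𝓣.sForm γ₁ γ₂ ΓW p.2 w := fun _ => rfl
    have e2 : ∀ v : 𝓣.feSpace 1, (Φ p).2 v =
        - 𝓣.sForm γ₁ γ₂ ΓV p.1 v + 𝓣.aForm κ ΓV ΓW v p.2 := fun _ => rfl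
    constructor
    · rintro ⟨h1, h2⟩
      refine Prod.ext (LinearMap.ext fun w => ?_) (LinearMap.ext fun v => ?_)
      · rw [e1, h1 w w.2]; rfl
      · rw [e2, neg_add_eq_sub, h2 v v.2]; rfl
    · intro h
      refine ⟨fun w hw => ?_, fun v hv => ?_⟩
      · rw [← e1 ⟨w, hw⟩, h]; rfl
      · rw [← neg_add_eq_sub, ← e2 ⟨v, hv⟩, h]; rfl
  simp only [hiff]
  exact Function.Bijective.existsUnique ⟨hinj, hsurj⟩ _
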